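/- Let $\mathbf U$ be the unit disk, $\mathbf T$ the unit circle, $n\ge 1$, and for a map $u$ from $\mathbf U$ to $\mathbf R^n$ let $J_u=\sqrt{|u_x|^2|u_y|^2-\langle u_x,u_y\rangle^2}$. For bounded measurable $F:\mathbf T\to\mathbf R^n$ let $$P[F](re^{i\varphi})=\int_0^{2\pi}\frac{1-r^2}{2\pi(1-2r\cos(t-\varphi)+r^2)}\,F(e^{it})\,dt .$$ A parametrized Jordan curve is a $C^1$ diffeomorphism $h$ of $\mathbf T$ onto a curve $h(\mathbf T)\subset\mathbf R^n$: $h$ is injective, and $h(t):=h(e^{it})$ is $C^1$ with nowhere vanishing derivative $h'(t)$. It is called Dini smooth if the modulus of continuity $\omega(\delta)=\sup_{|x-y|\le\delta}|h'(x)-h'(y)|$ satisfies $\int_0^l\omega(t)\,t^{-1}dt<\infty$ for some $l>0$, and $C^{1,\mu}$ if $|h'(x)-h'(y)|\le C|x-y|^\mu$ for some $C$ and all real $x,y$. A weak homeomorphism of $\mathbf T$ onto a Jordan curve $\gamma$ is a continuous surjection $\mathbf T\to\gamma$ such that the preimage of every point of $\gamma$ is connected. Put $$\mathcal K_h(e^{is},e^{it})=\sqrt{|h(t)-h(s)|^2|h'(s)|^2-\langle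 h(t)-h(s),h'(s)\rangle^2}.$$ (a) Let $h$ be Dini smooth, let $F$ be a Lipschitz weak homeomorphism of $\mathbf T$ onto $h(\mathbf T)$, let $f:\mathbf R\to\mathbf R$ be continuous with $F(e^{it})=h(e^{if(t)})$ for all $t$, and let $u=P[F]$. Then for almost every $\tau\in[0,2\pi]$ the function $f$ is differentiable at $\tau$, the limit $J_u(e^{i\tau}):=\lim_{r\to1^-}J_u(re^{i\tau})$ exists and is finite, and $$J_u(e^{i\tau})\le |f'(\tau)|\int_0^{2\pi}\frac{\mathcal K_h(e^{if(\tau)},e^{if(t)})}{4\pi\sin^2\frac{t-\tau}{2}}\,dt ,\qquad \int_0^{2\pi}\frac{\mathcal K_h(e^{if(\tau)},e^{if(t)})}{4\pi\sin^2\frac{t-\tau}{2}}\,dt<\infty .$$ (If $F$ has the same orientation as $h$, then $f$ is nondecreasing and $|f'(\tau)|=f'(\tau)$.) (b) Let $0<\mu\le1$, let $h$ be $C^{1,\mu}$, and let $f:\mathbf R\to\mathbf R$ be continuous with $F(e^{it})=h(e^{if(t)})$ for all $t$. Assume either that $F$ is a Lipschitz weak homeomorphism of $\mathbf T$ onto $h(\mathbf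 T)$, or that $F$ is injective and $u=P[F]$ is Lipschitz on $\mathbf U$. Then for almost every $\varphi\in[0,2\pi]$ the function $f$ is differentiable at $\varphi$, the limit $J_u(e^{i\varphi})=\lim_{r\to1^-}J_u(re^{i\varphi})$ exists and is finite, and $$J_u(e^{i\varphi})\le C_h\,|f'(\varphi)|\int_{-\pi}^{\pi}\frac{|F(e^{i(\varphi+x)})-F(e^{i\varphi})|^{1+\mu}}{\pi|e^{ix}-1|^2}\,dx ,$$ where the integral is finite and $$C_h=\frac{1}{(1+\mu)\,m_h^{\mu}}\,\sup_{x\ne y}\frac{|h'(x)-h'(y)|}{|x-y|^\mu},\qquad m_h=\inf_{0<|x-y|\le\pi}\frac{|h(e^{ix})-h(e^{iy})|}{|x-y|}>0 .$$ -/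

import Mathlib

open MeasureTheory Set Filter Topology

noncomputable section

/-- Euclidean `n`-space. -/
abbrev EucSpace (n : ℕ) : Type := EuclideanSpace ℝ (Fin n)

/-- The `2π`-periodic function `t ↦ g(e^{it})`, written `g(t)` for short; its derivative
`deriv (circleLift g) t` is what is meant by `g'(t)`. -/
def circleLift {n : ℕ} (g : Circle → EucSpace n) (t : ℝ) : EucSpace n :=
  g (Circle.exp t)

/-- `h` is a `C¹` diffeomorphism of the unit circle onto the Jordan curve `Set.range h`. -/
structure IsSmoothJordanParam {n : ℕ} (h : Circle → EucSpace n) : Prop where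
  injective : Function.Injective h
  contDiff : ContDiff ℝ 1 (circleLift h)
  deriv_ne_zero : ∀ t : ℝ, deriv (circleLift h) t ≠ 0

/-- The modulus of continuity `ω(δ) = sup {|g(x) - g(y)| : |x - y| ≤ δ}` of a bounded function
on the line. -/
def modulusOfContinuity {n : ℕ} (g : ℝ → EucSpace n) (δ : ℝ) : ℝ :=
  sSup {r : ℝ | ∃ x y : ℝ, |x - y| ≤ δ ∧ r = ‖g x - g y‖}

/-- Dini continuity of a positive nondecreasing continuous function with `ω(0) = 0`. -/
structure IsDiniContinuous (ω : ℝ → ℝ) : Prop where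
  zero : ω 0 = 0
  pos : ∀ t : ℝ, 0 < t → 0 < ω t
  monotoneOn : MonotoneOn ω (Ici 0)
  continuousOn : ContinuousOn ω (Ici 0)
  integrable : ∃ l : ℝ, 0 < l ∧ IntegrableOn (fun t : ℝ => ω t / t) (Ioc 0 l)

/-- `h` is a Dini smooth parametrization of the Jordan curve `Set.range h`: a `C¹`
diffeomorphism such that the modulus of continuity of `h'` is Dini continuous. -/
structure IsDiniSmoothParam {n : ℕ} (h : Circle → EucSpace n) : Prop where
  param : IsSmoothJordanParam h
  dini : IsDiniContinuous (modulusOfContinuity (deriv (circleLift h)))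

/-- `h` is a `C^{1,μ}` parametrization of the Jordan curve `Set.range h`. -/
structure IsC1HolderParam {n : ℕ} (μ : ℝ) (h : Circle → EucSpace n) : Prop where
  param : IsSmoothJordanParam h
  holder : ∃ C : ℝ, ∀ x y : ℝ,
    ‖deriv (circleLift h) x - deriv (circleLift h) y‖ ≤ C * |x - y| ^ μ

/-- `sup_{x ≠ y} |h'(x) - h'(y)| / |x - y|^μ`. -/
def holderSeminormDeriv {n : ℕ} (μ : ℝ) (h : Circle → EucSpace n) : ℝ :=
  sSup {r : ℝ | ∃ x y : ℝ, x ≠ y ∧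
    r = ‖deriv (circleLift h) x - deriv (circleLift h) y‖ / |x - y| ^ μ}

/-- `inf |h(e^{ix}) - h(e^{iy})| / |x - y|` over `0 < |x - y| ≤ π`, that is, the infimum of
`|h(z) - h(w)|` divided by the length of the shorter arc of the circle between `z` and `w`. -/
def chordArcInf {n : ℕ} (h : Circle → EucSpace n) : ℝ :=
  sInf {r : ℝ | ∃ x y : ℝ, 0 < |x - y| ∧ |x - y| ≤ Real.pi ∧
    r = ‖circleLift h x - circleLift h y‖ / |x - y|}

/-- `F` is a weak homeomorphism of the unit circle onto the Jordan curve `γ`: a continuous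
monotone surjection, the preimage of every point of `γ` being a point or a proper closed arc. -/
structure IsWeakHomeo {n : ℕ} (F : Circle → EucSpace n) (γ : Set (EucSpace n)) : Prop where
  continuous : Continuous F
  range_eq : range F = γ
  isConnected_fiber : ∀ p ∈ γ, IsConnected (F ⁻¹' {p})

/-- The Poisson integral `P[F]`. For `w = r e^{iφ}` in the unit disk,
`poissonKernel 0 w (e^{it}) = (1 - r²) / (1 - 2 r cos (t - φ) + r²)`. -/
def poissonExtension {n : ℕ} (F : Circle → EucSpace n) (w : ℂ) : EucSpace n :=
  ∫ t in (0 : ℝ)..2 * Real.pi,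
    (poissonKernel 0 w (Circle.exp t : ℂ) / (2 * Real.pi)) • F (Circle.exp t)

/-- The Jacobian `J_u(z) = √(|u_x|² |u_y|² - ⟨u_x, u_y⟩²)` of a map from the plane to
`n`-space. -/
def surfaceJacobian {n : ℕ} (u : ℂ → EucSpace n) (z : ℂ) : ℝ :=
  √(‖fderiv ℝ u z 1‖ ^ 2 * ‖fderiv ℝ u z Complex.I‖ ^ 2
    - inner ℝ (fderiv ℝ u z 1) (fderiv ℝ u z Complex.I) ^ 2)

/-- The kernel `K_h(e^{is}, e^{it}) = √(|h(t) - h(s)|² |h'(s)|² - ⟨h(t) - h(s), h'(s)⟩²)`. -/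
def kernelK {n : ℕ} (h : Circle → EucSpace n) (s t : ℝ) : ℝ :=
  √(‖circleLift h t - circleLift h s‖ ^ 2 * ‖deriv (circleLift h) s‖ ^ 2
    - inner ℝ (circleLift h t - circleLift h s) (deriv (circleLift h) s) ^ 2)

end

/-! ### The Poisson kernel, its angular derivative, and Fatou's theorem -/

noncomputable section

/-! Write `u = P[F]`. In the rotated frame of radial and angular directions `J_u` is the area of the
parallelogram spanned by the radial and angular derivatives of `u`, so it suffices to control their
radial limits.

Existence of the limits. The boundary map is Lipschitz in every case. Each coordinate of `u` is `2
Re A - c₀` with `A` a power series whose coefficients are Fourier coefficients of that coordinate.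
Parseval applied to difference quotients gives `∑ (m|c_m|)² < ∞`. Hence the boundary function of `A`
has bounded variation and is differentiable almost everywhere, and Fatou's theorem gives a radial
limit of `i w A'(w)` there. Since `A` is holomorphic, this one complex limit yields both the radial
and the angular derivative of `u` (`exists_holomorphic_of_lipschitz`,
`ae_tendsto_fderiv_poissonExtension`). The angular limit is `F'(τ)`; call the radial one `G`, so
that `J_u → gramArea G F'(τ)`.

The inequality. `G` is also the limit of `(F(τ) - u(re^{iτ}))/(1-r)`, that is, of minus the integral
of `F(τ+x) - F(τ)` against `P_r(x)/(2π(1-r))`. For fixed `b`, `gramArea · b` is the norm of a linear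
map, so it passes under the integral. The weight is at most `(1+r)/(2r)` times `1/(4π sin²(x/2))`,
and `r → 1` gives the bound (`gramArea_limit_le_integral`). The chain rule `F'(τ) = f'(τ) h'(f(τ))`
turns the integrand into `|f'(τ)| K_h`.

Finiteness. The area is unchanged when one vector is altered by a multiple of the other, so only the
Taylor remainder of `h` counts. It is controlled by the modulus of continuity in (a), and by the
Hölder seminorm together with the chord-arc constant in (b). -/

/-- The Poisson kernel of the unit disk at radius `r` and angle `x`. -/
def radialPoisson (r x : ℝ) : ℝ := (1 - r ^ 2) / (1 - 2 * r * Real.cos x + r ^ 2)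

/-- Minus the angular derivative of `radialPoisson`. -/
def angularPoisson (r x : ℝ) : ℝ :=
  2 * r * (1 - r ^ 2) * Real.sin x / (1 - 2 * r * Real.cos x + r ^ 2) ^ 2

theorem poisson_denom_eq (r x : ℝ) :
    1 - 2 * r * Real.cos x + r ^ 2 = (1 - r) ^ 2 + 4 * r * Real.sin (x / 2) ^ 2 := by
  have h : Real.cos x = 1 - 2 * Real.sin (x / 2) ^ 2 := by
    rw [Real.sin_sq_eq_half_sub]; ring_nf
  rw [h]; ring

theorem poisson_denom_pos {r : ℝ} (h0 : 0 ≤ r) (h1 : r < 1) (x : ℝ) :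
    0 < 1 - 2 * r * Real.cos x + r ^ 2 := by
  rw [poisson_denom_eq]
  have : 0 < (1 - r) ^ 2 := by have : 0 < 1 - r := by linarith
                               positivity
  positivity

theorem radialPoisson_nonneg {r : ℝ} (h0 : 0 ≤ r) (h1 : r < 1) (x : ℝ) :
    0 ≤ radialPoisson r x :=
  div_nonneg (by nlinarith) (poisson_denom_pos h0 h1 x).le

theorem continuous_radialPoisson {r : ℝ} (h0 : 0 ≤ r) (h1 : r < 1) :
    Continuous (radialPoisson r) := by
  unfold radialPoisson
  exact continuous_const.div (by fun_prop) fun x => (poisson_denom_pos h0 h1 x).ne'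

theorem continuous_angularPoisson {r : ℝ} (h0 : 0 ≤ r) (h1 : r < 1) :
    Continuous (angularPoisson r) := by
  unfold angularPoisson
  exact Continuous.div (by fun_prop) (by fun_prop)
    fun x => pow_ne_zero 2 (poisson_denom_pos h0 h1 x).ne'

theorem hasDerivAt_radialPoisson {r : ℝ} (h0 : 0 ≤ r) (h1 : r < 1) (x : ℝ) :
    HasDerivAt (radialPoisson r) (-angularPoisson r x) x := by
  unfold radialPoisson angularPoisson
  have hD : HasDerivAt (fun x => 1 - 2 * r * Real.cos x + r ^ 2) (2 * r * Real.sin x) x := by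
    have := (((Real.hasDerivAt_cos x).const_mul (2 * r)).const_sub 1).add_const (r ^ 2)
    exact this.congr_deriv (by ring)
  refine ((hasDerivAt_const x (1 - r ^ 2)).div hD (poisson_denom_pos h0 h1 x).ne').congr_deriv ?_
  ring

theorem radialPoisson_periodic (r : ℝ) : Function.Periodic (radialPoisson r) (2 * Real.pi) := by
  intro x; simp [radialPoisson]

theorem sq_div_pi_le_sin_half_sq {x : ℝ} (hx : |x| ≤ Real.pi) :
    (x / Real.pi) ^ 2 ≤ Real.sin (x / 2) ^ 2 := by
  have h := Real.mul_abs_le_abs_sin (x := x / 2) (by rw [abs_div]; simp; linarith)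
  have h' : |x / Real.pi| ≤ |Real.sin (x / 2)| := by
    refine le_trans (le_of_eq ?_) h
    rw [abs_div, abs_div, abs_of_pos Real.pi_pos]; simp only [Nat.abs_ofNat]; field_simp
  exact sq_le_sq.2 h'

theorem le_poisson_denom {r δ x : ℝ} (hr : 1 / 2 < r) (hδ : 0 < δ) (hx : |x| ≤ Real.pi)
    (hδx : δ ≤ |x|) : 2 * (δ / Real.pi) ^ 2 ≤ 1 - 2 * r * Real.cos x + r ^ 2 := by
  rw [poisson_denom_eq]
  have h1 := sq_div_pi_le_sin_half_sq hx
  have h2 : (δ / Real.pi) ^ 2 ≤ (x / Real.pi) ^ 2 := by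
    rw [div_pow, div_pow, ← sq_abs x]; gcongr
  nlinarith [sq_nonneg (1 - r), sq_nonneg (Real.sin (x / 2))]

theorem poissonKernel_eq_radialPoisson (r τ t : ℝ) :
    poissonKernel 0 ((r : ℂ) * (Circle.exp τ : ℂ)) (Circle.exp t : ℂ) = radialPoisson r (t - τ) := by
  unfold poissonKernel radialPoisson
  have e : ‖(Circle.exp t : ℂ) - (r : ℂ) * (Circle.exp τ : ℂ)‖ ^ 2
      = 1 - 2 * r * Real.cos (t - τ) + r ^ 2 := by
    rw [← Complex.normSq_eq_norm_sq, Circle.coe_exp, Circle.coe_exp, Complex.exp_mul_I,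
      Complex.exp_mul_I, Complex.normSq_apply, Real.cos_sub]
    simp only [Complex.sub_re, Complex.add_re, Complex.cos_ofReal_re, Complex.mul_re,
      Complex.sin_ofReal_re, Complex.sin_ofReal_im, Complex.I_re, Complex.I_im, Complex.ofReal_re,
      Complex.ofReal_im, Complex.sub_im, Complex.add_im, Complex.cos_ofReal_im, Complex.mul_im,
      Complex.add_re]
    ring_nf
    nlinarith [Real.sin_sq_add_cos_sq t, Real.sin_sq_add_cos_sq τ]
  simp only [sub_zero, e]
  simp

theorem integral_shift_of_periodic {E : Type*} [NormedAddCommGroup E] [NormedSpace ℝ E]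
    {φ : ℝ → E} (hφ : Function.Periodic φ (2 * Real.pi)) (τ : ℝ) :
    ∫ t in (0 : ℝ)..2 * Real.pi, φ t = ∫ x in (-Real.pi)..Real.pi, φ (τ + x) := by
  rw [intervalIntegral.integral_comp_add_left]
  have := hφ.intervalIntegral_add_eq 0 (τ + -Real.pi)
  rw [zero_add] at this
  rw [this]; congr 1; ring

theorem exists_norm_le_of_periodic {E : Type*} [NormedAddCommGroup E] {φ : ℝ → E}
    (hφ : Continuous φ) (hper : Function.Periodic φ (2 * Real.pi)) : ∃ B, ∀ x, ‖φ x‖ ≤ B := by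
  obtain ⟨B, hB⟩ := (isCompact_Icc (a := (0 : ℝ)) (b := 2 * Real.pi)).exists_bound_of_continuousOn
    hφ.continuousOn
  refine ⟨B, fun x => ?_⟩
  obtain ⟨y, hy, hxy⟩ := hper.exists_mem_Ico₀ Real.two_pi_pos x
  rw [hxy]
  exact hB y (Ico_subset_Icc_self hy)

/-- The Poisson formula for the holomorphic function `z ^ m`, evaluated at the point `r`. -/
theorem integral_radialPoisson_mul_exp {r : ℝ} (h0 : 0 ≤ r) (h1 : r < 1) (m : ℕ) :
    ∫ x in (-Real.pi)..Real.pi, (radialPoisson r x : ℂ) * Complex.exp (x * Complex.I) ^ m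
      = 2 * Real.pi * (r : ℂ) ^ m := by
  have hd : DiffContOnCl ℂ (fun z : ℂ => z ^ m) (Metric.ball 0 1) :=
    (by fun_prop : Differentiable ℂ (fun z : ℂ => z ^ m)).diffContOnCl
  have hw : (r : ℂ) ∈ Metric.ball (0 : ℂ) 1 := by simp [abs_of_nonneg h0, h1]
  have h := hd.circleAverage_poissonKernel_smul hw
  rw [Real.circleAverage_def] at h
  have e : ∀ θ : ℝ, (poissonKernel 0 (r : ℂ) • fun z : ℂ => z ^ m) (circleMap 0 1 θ)
      = (radialPoisson r θ : ℂ) * Complex.exp (θ * Complex.I) ^ m := by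
    intro θ
    have := poissonKernel_eq_radialPoisson r 0 θ
    simp only [Circle.exp_zero, Circle.coe_one, mul_one, sub_zero, Circle.coe_exp] at this
    simp [circleMap, this]
  simp only [e] at h
  rw [integral_shift_of_periodic _ 0] at h
  · simp only [zero_add] at h
    rw [← h, Complex.real_smul]
    rw [← mul_assoc]
    push_cast
    rw [mul_inv_cancel₀ (by simp), one_mul]
  · intro x
    simp only [radialPoisson_periodic r x]
    congr 2
    push_cast
    rw [add_mul, Complex.exp_add, Complex.exp_two_pi_mul_I, mul_one]

theorem integral_radialPoisson {r : ℝ} (h0 : 0 ≤ r) (h1 : r < 1) :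
    ∫ x in (-Real.pi)..Real.pi, radialPoisson r x = 2 * Real.pi := by
  have := integral_radialPoisson_mul_exp h0 h1 0
  simp only [pow_zero, mul_one] at this
  rw [intervalIntegral.integral_ofReal] at this
  exact_mod_cast this

theorem integral_angularPoisson_mul_exp {r : ℝ} (h0 : 0 ≤ r) (h1 : r < 1) (m : ℕ) :
    ∫ x in (-Real.pi)..Real.pi, (angularPoisson r x : ℂ) * Complex.exp (x * Complex.I) ^ m
      = 2 * Real.pi * (m * Complex.I * (r : ℂ) ^ m) := by
  have hv : ∀ x : ℝ, HasDerivAt (fun x : ℝ => Complex.exp (x * Complex.I) ^ m)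
      (m * Complex.I * Complex.exp (x * Complex.I) ^ m) x := by
    intro x
    have h := ((Complex.hasDerivAt_exp ((x : ℂ) * Complex.I)).comp x
      ((Complex.ofRealCLM.hasDerivAt (x := x)).mul_const Complex.I)).pow m
    refine h.congr_deriv ?_
    rcases m with _ | m
    · simp
    · simp; ring
  have hu : ∀ x : ℝ, HasDerivAt (fun x : ℝ => (radialPoisson r x : ℂ))
      (-(angularPoisson r x : ℂ)) x := by
    intro x
    exact_mod_cast (hasDerivAt_radialPoisson h0 h1 x).ofReal_comp
  have hQ := continuous_angularPoisson h0 h1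
  have ibp := intervalIntegral.integral_mul_deriv_eq_deriv_mul (a := -Real.pi) (b := Real.pi)
    (fun x _ => hu x) (fun x _ => hv x)
    (Continuous.intervalIntegrable (by fun_prop) _ _)
    (Continuous.intervalIntegrable (by fun_prop) _ _)
  have e1 : ∀ x : ℝ, (radialPoisson r x : ℂ) * (m * Complex.I * Complex.exp (x * Complex.I) ^ m)
      = m * Complex.I * ((radialPoisson r x : ℂ) * Complex.exp (x * Complex.I) ^ m) := by
    intro x; ring
  simp only [e1, intervalIntegral.integral_const_mul, neg_mul, intervalIntegral.integral_neg] at ibp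
  rw [integral_radialPoisson_mul_exp h0 h1] at ibp
  have e2 : radialPoisson r (-Real.pi) = radialPoisson r Real.pi := by simp [radialPoisson]
  have e3 : Complex.exp (((-Real.pi : ℝ) : ℂ) * Complex.I)
      = Complex.exp ((Real.pi : ℂ) * Complex.I) := by
    rw [Complex.exp_pi_mul_I]; push_cast; rw [neg_mul, Complex.exp_neg, Complex.exp_pi_mul_I]
    norm_num
  rw [e2, e3] at ibp
  linear_combination -ibp

theorem integral_angularPoisson {r : ℝ} (h0 : 0 ≤ r) (h1 : r < 1) :
    ∫ x in (-Real.pi)..Real.pi, angularPoisson r x = 0 := by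
  have := integral_angularPoisson_mul_exp h0 h1 0
  simp only [pow_zero, mul_one] at this
  rw [intervalIntegral.integral_ofReal] at this
  have h : ((∫ x in (-Real.pi)..Real.pi, angularPoisson r x : ℝ) : ℂ) = 0 := by simpa using this
  exact_mod_cast h

/-- Integration by parts; the boundary terms at `±π` give the correction, which vanishes as `r → 1`.
Thus `x * angularPoisson r x / (2π)` has mass tending to one and can serve as an approximate
identity. -/
theorem integral_mul_angularPoisson {r : ℝ} (h0 : 0 ≤ r) (h1 : r < 1) :
    ∫ x in (-Real.pi)..Real.pi, x * angularPoisson r x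
      = 2 * Real.pi - 2 * Real.pi * ((1 - r) / (1 + r)) := by
  have hQ := continuous_angularPoisson h0 h1
  have ibp := intervalIntegral.integral_mul_deriv_eq_deriv_mul (a := -Real.pi) (b := Real.pi)
    (fun x _ => hasDerivAt_id x) (fun x _ => hasDerivAt_radialPoisson h0 h1 x)
    (Continuous.intervalIntegrable (by fun_prop) _ _)
    (Continuous.intervalIntegrable (by fun_prop) _ _)
  simp only [id, mul_neg, one_mul, intervalIntegral.integral_neg, integral_radialPoisson h0 h1]
    at ibp
  have e2 : radialPoisson r (-Real.pi) = (1 - r) / (1 + r) := by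
    simp only [radialPoisson, Real.cos_neg, Real.cos_pi]
    have : 1 + r ≠ 0 := by linarith
    rw [show 1 - 2 * r * -1 + r ^ 2 = (1 + r) * (1 + r) by ring]
    field_simp; ring
  have e3 : radialPoisson r Real.pi = (1 - r) / (1 + r) := by
    rw [← e2]; simp [radialPoisson]
  rw [e2, e3] at ibp
  linarith

/-- Approximate identities: nonnegative kernels of mass tending to one that are `O(1 - r)` away from
the origin. The range `r > 1/2` keeps the Poisson denominator bounded below by `2 sin²(x/2)`. -/
theorem tendsto_integral_peak {E : Type*} [NormedAddCommGroup E] [NormedSpace ℝ E]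
    [CompleteSpace E] {φ : ℝ → ℝ → ℝ} {g : ℝ → E} {a : E}
    (hφ0 : ∀ r ∈ Ioo (1 / 2 : ℝ) 1, ∀ x, |x| ≤ Real.pi → 0 ≤ φ r x)
    (hφc : ∀ r ∈ Ioo (1 / 2 : ℝ) 1, Continuous (φ r))
    (hφδ : ∀ δ > 0, ∃ C, ∀ r ∈ Ioo (1 / 2 : ℝ) 1, ∀ x, |x| ≤ Real.pi → δ ≤ |x| →
      φ r x ≤ C * (1 - r))
    (hφi : Tendsto (fun r => ∫ x in (-Real.pi)..Real.pi, φ r x) (𝓝[<] 1) (𝓝 1))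
    (hg : IntervalIntegrable g volume (-Real.pi) Real.pi) (hga : Tendsto g (𝓝 0) (𝓝 a)) :
    Tendsto (fun r => ∫ x in (-Real.pi)..Real.pi, φ r x • g x) (𝓝[<] 1) (𝓝 a) := by
  have hπ : -Real.pi ≤ Real.pi := by linarith [Real.pi_pos]
  have hr : ∀ᶠ r : ℝ in 𝓝[<] 1, r ∈ Ioo (1 / 2 : ℝ) 1 :=
    Ioo_mem_nhdsLT (by norm_num)
  have habs : ∀ x ∈ Ioc (-Real.pi) Real.pi, |x| ≤ Real.pi := fun x hx =>
    abs_le.2 ⟨hx.1.le, hx.2⟩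
  simp only [intervalIntegral.integral_of_le hπ] at hφi ⊢
  refine tendsto_setIntegral_peak_smul_of_integrableOn_of_tendsto (x₀ := 0) measurableSet_Ioc
    measurableSet_Ioc subset_rfl self_mem_nhdsWithin (by simp) ?_ ?_ hφi ?_
    ((intervalIntegrable_iff_integrableOn_Ioc_of_le hπ).1 hg) (hga.mono_left nhdsWithin_le_nhds)
  · filter_upwards [hr] with r hr x hx using hφ0 r hr x (habs x hx)
  · intro u hu h0u
    obtain ⟨δ, hδ, hδu⟩ := Metric.isOpen_iff.1 hu 0 h0u
    obtain ⟨C, hC⟩ := hφδ δ hδ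
    rw [Metric.tendstoUniformlyOn_iff]
    intro ε hε
    have hlim : Tendsto (fun r : ℝ => C * (1 - r)) (𝓝[<] 1) (𝓝 0) := by
      have : Continuous (fun r : ℝ => C * (1 - r)) := by fun_prop
      simpa using (this.tendsto 1).mono_left nhdsWithin_le_nhds
    filter_upwards [hr, hlim.eventually (gt_mem_nhds hε)] with r hr hrε x hx
    have hx1 := habs x hx.1
    have hx2 : δ ≤ |x| := by
      by_contra h
      exact hx.2 (hδu (by simpa using h))
    simp only [Pi.zero_apply, dist_zero_left, Real.norm_eq_abs, abs_of_nonneg (hφ0 r hr x hx1)]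
    exact (hC r hr x hx1 hx2).trans_lt hrε
  · filter_upwards [hr] with r hr using (hφc r hr).aestronglyMeasurable

theorem tendsto_integral_radialPoisson {E : Type*} [NormedAddCommGroup E] [NormedSpace ℝ E]
    [CompleteSpace E] {g : ℝ → E} (hg : Continuous g) (τ : ℝ) :
    Tendsto (fun r => ∫ x in (-Real.pi)..Real.pi, (radialPoisson r x / (2 * Real.pi)) • g (τ + x))
      (𝓝[<] 1) (𝓝 (g τ)) := by
  refine tendsto_integral_peak (φ := fun r x => radialPoisson r x / (2 * Real.pi))
    (g := fun x => g (τ + x)) ?_ ?_ ?_ ?_ (Continuous.intervalIntegrable (by fun_prop) _ _) ?_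
  · intro r hr x _
    have := radialPoisson_nonneg (by linarith [hr.1]) hr.2 x
    have := Real.pi_pos
    positivity
  · intro r hr
    have := continuous_radialPoisson (by linarith [hr.1]) hr.2
    fun_prop
  · intro δ hδ
    refine ⟨2 / (2 * (δ / Real.pi) ^ 2) / (2 * Real.pi), fun r hr x hx hδx => ?_⟩
    have hd := le_poisson_denom hr.1 hδ hx hδx
    have hπ := Real.pi_pos
    have h1 : 1 - r ^ 2 ≤ 2 * (1 - r) := by nlinarith [hr.1, hr.2]
    have h2 : 0 ≤ 1 - r := by linarith [hr.2]
    calc radialPoisson r x / (2 * Real.pi)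
        ≤ 2 * (1 - r) / (2 * (δ / Real.pi) ^ 2) / (2 * Real.pi) := by
          unfold radialPoisson; gcongr
      _ = _ := by ring
  · refine tendsto_const_nhds.congr' ?_
    filter_upwards [Ioo_mem_nhdsLT (show (0 : ℝ) < 1 by norm_num)] with r hr
    rw [intervalIntegral.integral_div, integral_radialPoisson hr.1.le hr.2, div_self]
    have := Real.pi_pos
    positivity
  · have : Continuous fun x => g (τ + x) := by fun_prop
    simpa using this.tendsto 0

/-- **Fatou's theorem** for the angular derivative of a Poisson integral. -/
theorem tendsto_integral_angularPoisson {E : Type*} [NormedAddCommGroup E] [NormedSpace ℝ E]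
    [CompleteSpace E] {g : ℝ → E} (hg : Continuous g) {τ : ℝ} (hd : DifferentiableAt ℝ g τ) :
    Tendsto (fun r => ∫ x in (-Real.pi)..Real.pi, (angularPoisson r x / (2 * Real.pi)) • g (τ + x))
      (𝓝[<] 1) (𝓝 (deriv g τ)) := by
  have hπ := Real.pi_pos
  have hxs0 : ∀ x, |x| ≤ Real.pi → 0 ≤ x * Real.sin x := by
    intro x hx
    rcases le_total 0 x with h | h
    · exact mul_nonneg h (Real.sin_nonneg_of_nonneg_of_le_pi h ((le_abs_self x).trans hx))
    · exact mul_nonneg_of_nonpos_of_nonpos h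
        (Real.sin_nonpos_of_nonpos_of_neg_pi_le h (by linarith [neg_abs_le x]))
  -- Since `g(τ+x) - g(τ) = x · dslope g τ (τ+x)`, the factor `x` moves onto the kernel, which
  -- becomes nonnegative because `x sin x ≥ 0` on `[-π, π]`. Differentiability at `τ` makes the
  -- slope continuous there.
  have hdc : Continuous (dslope g τ) := by
    rw [← continuousOn_univ]
    exact (continuousOn_dslope univ_mem).2 ⟨hg.continuousOn, hd⟩
  have hpeak : Tendsto (fun r => ∫ x in (-Real.pi)..Real.pi,
      (x * angularPoisson r x / (2 * Real.pi)) • dslope g τ (τ + x)) (𝓝[<] 1)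
      (𝓝 (deriv g τ)) := by
    refine tendsto_integral_peak (φ := fun r x => x * angularPoisson r x / (2 * Real.pi))
      (g := fun x => dslope g τ (τ + x)) ?_ ?_ ?_ ?_
      (Continuous.intervalIntegrable (by fun_prop) _ _) ?_
    · intro r hr x hx
      have hxs := hxs0 x hx
      have h1 : 0 ≤ 1 - r ^ 2 := by nlinarith [hr.1, hr.2]
      have h2 : 0 ≤ r := by linarith [hr.1]
      have e : x * angularPoisson r x / (2 * Real.pi) = 2 * r * (1 - r ^ 2) * (x * Real.sin x)
          / (1 - 2 * r * Real.cos x + r ^ 2) ^ 2 / (2 * Real.pi) := by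
        unfold angularPoisson; ring
      rw [e]; positivity
    · intro r hr
      have := continuous_angularPoisson (by linarith [hr.1]) hr.2
      fun_prop
    · intro δ hδ
      refine ⟨2 * 1 * 2 * Real.pi / (2 * (δ / Real.pi) ^ 2) ^ 2 / (2 * Real.pi),
        fun r hr x hx hδx => ?_⟩
      have hdn := le_poisson_denom hr.1 hδ hx hδx
      have h1 : 1 - r ^ 2 ≤ 2 * (1 - r) := by nlinarith [hr.1, hr.2]
      have h1' : 0 ≤ 1 - r ^ 2 := by nlinarith [hr.1, hr.2]
      have h2 : 0 ≤ 1 - r := by linarith [hr.2]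
      have h3 : 0 ≤ r := by linarith [hr.1]
      have hxs : x * Real.sin x ≤ Real.pi := by
        refine (le_abs_self _).trans ?_
        rw [abs_mul]
        nlinarith [Real.abs_sin_le_one x, abs_nonneg x, abs_nonneg (Real.sin x)]
      calc x * angularPoisson r x / (2 * Real.pi)
          = 2 * r * (1 - r ^ 2) * (x * Real.sin x)
            / (1 - 2 * r * Real.cos x + r ^ 2) ^ 2 / (2 * Real.pi) := by
            unfold angularPoisson; ring
        _ ≤ 2 * 1 * (2 * (1 - r)) * Real.pi
            / (2 * (δ / Real.pi) ^ 2) ^ 2 / (2 * Real.pi) := by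
            have := hr.2.le
            have := hxs0 x hx
            gcongr
        _ = _ := by ring
    · have hlim : Tendsto (fun r : ℝ => 1 - (1 - r) / (1 + r)) (𝓝[<] 1) (𝓝 1) := by
        have : ContinuousAt (fun r : ℝ => 1 - (1 - r) / (1 + r)) 1 :=
          continuousAt_const.sub (ContinuousAt.div (by fun_prop) (by fun_prop) (by norm_num))
        simpa [ContinuousAt] using this.tendsto.mono_left nhdsWithin_le_nhds
      refine hlim.congr' ?_
      filter_upwards [Ioo_mem_nhdsLT (show (0 : ℝ) < 1 by norm_num)] with r hr
      rw [intervalIntegral.integral_div, integral_mul_angularPoisson hr.1.le hr.2]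
      field_simp
    · have : Continuous fun x => dslope g τ (τ + x) := by fun_prop
      simpa using this.tendsto 0
  refine hpeak.congr' ?_
  filter_upwards [Ioo_mem_nhdsLT (show (0 : ℝ) < 1 by norm_num)] with r hr
  have hQ := continuous_angularPoisson hr.1.le hr.2
  -- The term with the constant `g τ` drops out because `angularPoisson` has mean zero.
  have e : ∀ x, (x * angularPoisson r x / (2 * Real.pi)) • dslope g τ (τ + x)
      = (angularPoisson r x / (2 * Real.pi)) • g (τ + x)
        - (angularPoisson r x / (2 * Real.pi)) • g τ := by
    intro x
    rw [← smul_sub, ← sub_smul_dslope, smul_smul]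
    congr 1
    ring
  simp only [e]
  rw [intervalIntegral.integral_sub (Continuous.intervalIntegrable (by fun_prop) _ _)
    (Continuous.intervalIntegrable (by fun_prop) _ _), intervalIntegral.integral_smul_const,
    intervalIntegral.integral_div, integral_angularPoisson hr.1.le hr.2]
  simp

end

/-! ### Power series with square summable derivative coefficients -/

noncomputable section

theorem hasSum_intervalIntegral_of_norm_le {E : Type*} [NormedAddCommGroup E] [NormedSpace ℝ E]
    [CompleteSpace E] {F : ℕ → ℝ → E} {u : ℕ → ℝ} (hu : Summable u) (hF : ∀ n, Continuous (F n))
    (hFu : ∀ n x, ‖F n x‖ ≤ u n) (a b : ℝ) :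
    HasSum (fun n => ∫ x in a..b, F n x) (∫ x in a..b, ∑' n, F n x) := by
  refine intervalIntegral.hasSum_integral_of_dominated_convergence (fun n _ => u n)
    (fun n => (hF n).aestronglyMeasurable) (fun n => ae_of_all _ fun x _ => hFu n x)
    (ae_of_all _ fun _ _ => hu) (by simp) (ae_of_all _ fun x _ => ?_)
  exact (hu.of_norm_bounded fun n => hFu n x).hasSum

theorem eVariationOn_le_of_edist_le {E F : Type*} [PseudoEMetricSpace E] [PseudoEMetricSpace F]
    {f : ℝ → E} {V : ℝ → F} {s : Set ℝ}
    (h : ∀ x ∈ s, ∀ y ∈ s, edist (f x) (f y) ≤ edist (V x) (V y)) :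
    eVariationOn f s ≤ eVariationOn V s := by
  unfold eVariationOn
  exact iSup_mono fun p => Finset.sum_le_sum fun i _ => h _ (p.2.2.2 _) _ (p.2.2.2 _)

/-- The running integral of `‖f'‖` is monotone and its increments dominate those of `f`, so its
total increment bounds the variation. -/
theorem eVariationOn_Icc_le_integral_norm_deriv {E : Type*} [NormedAddCommGroup E]
    [NormedSpace ℝ E] [CompleteSpace E] {f f' : ℝ → E} (hf : ∀ x, HasDerivAt f (f' x) x)
    (hf' : Continuous f') {a b : ℝ} (hab : a ≤ b) :
    eVariationOn f (Icc a b) ≤ ENNReal.ofReal (∫ x in a..b, ‖f' x‖) := by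
  set V : ℝ → ℝ := fun x => ∫ y in a..x, ‖f' y‖
  have hint : ∀ x y, IntervalIntegrable (fun y => ‖f' y‖) volume x y :=
    fun x y => Continuous.intervalIntegrable (by fun_prop) _ _
  have hVsub : ∀ x y, V y - V x = ∫ t in x..y, ‖f' t‖ := fun x y =>
    intervalIntegral.integral_interval_sub_left (hint _ _) (hint _ _)
  have hVle : ∀ x y, x ≤ y → edist (f x) (f y) ≤ edist (V x) (V y) := by
    intro x y hxy
    rw [edist_dist, edist_dist]
    apply ENNReal.ofReal_le_ofReal
    rw [dist_comm, dist_comm (V x), dist_eq_norm, dist_eq_norm, hVsub,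
      ← intervalIntegral.integral_eq_sub_of_hasDerivAt (fun t _ => hf t)
        (hf'.intervalIntegrable _ _)]
    exact (intervalIntegral.norm_integral_le_integral_norm hxy).trans (le_abs_self _)
  have hmono : Monotone V := by
    intro x y hxy
    have : 0 ≤ ∫ t in x..y, ‖f' t‖ :=
      intervalIntegral.integral_nonneg hxy fun t _ => norm_nonneg _
    linarith [hVsub x y]
  calc eVariationOn f (Icc a b) ≤ eVariationOn V (Icc a b) := by
        refine eVariationOn_le_of_edist_le fun x _ y _ => ?_
        rcases le_total x y with h | h
        · exact hVle x y h
        · rw [edist_comm, edist_comm (V x)]; exact hVle y x h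
    _ = eVariationOn V (Icc a b ∩ Icc a b) := by rw [inter_self]
    _ = ENNReal.ofReal (V b - V a) :=
        (hmono.monotoneOn _).eVariationOn_eq (left_mem_Icc.2 hab) (right_mem_Icc.2 hab)
    _ = _ := by rw [hVsub]

theorem integral_exp_mul_I_zpow (k : ℤ) :
    ∫ t in (0 : ℝ)..2 * Real.pi, Complex.exp (k * Complex.I * t)
      = if k = 0 then 2 * Real.pi else 0 := by
  split_ifs with h
  · simp [h]
  · have hc : (k : ℂ) * Complex.I ≠ 0 := mul_ne_zero (by exact_mod_cast h) Complex.I_ne_zero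
    rw [integral_exp_mul_complex hc]
    have : Complex.exp ((k : ℂ) * Complex.I * ((2 * Real.pi : ℝ) : ℂ)) = 1 := by
      rw [Complex.exp_eq_one_iff]; exact ⟨k, by push_cast; ring⟩
    rw [this]; simp

theorem integral_norm_sq_trigPolynomial (a : ℕ → ℂ) (S : Finset ℕ) :
    ∫ t in (0 : ℝ)..2 * Real.pi, ‖∑ m ∈ S, a m * Complex.exp (t * Complex.I) ^ m‖ ^ 2
      = 2 * Real.pi * ∑ m ∈ S, ‖a m‖ ^ 2 := by
  have e : ∀ t : ℝ, ((‖∑ m ∈ S, a m * Complex.exp (t * Complex.I) ^ m‖ ^ 2 : ℝ) : ℂ)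
      = ∑ m ∈ S, ∑ k ∈ S, a m * (starRingEnd ℂ) (a k)
          * Complex.exp (((m : ℤ) - (k : ℤ) : ℤ) * Complex.I * t) := by
    intro t
    rw [Complex.ofReal_pow, ← Complex.mul_conj', map_sum, Finset.sum_mul_sum]
    refine Finset.sum_congr rfl fun m _ => Finset.sum_congr rfl fun k _ => ?_
    rw [map_mul, map_pow, ← Complex.exp_conj, ← Complex.exp_nat_mul, ← Complex.exp_nat_mul,
      mul_mul_mul_comm, ← Complex.exp_add]
    congr 2
    simp
    ring
  have h : ((∫ t in (0 : ℝ)..2 * Real.pi,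
      ‖∑ m ∈ S, a m * Complex.exp (t * Complex.I) ^ m‖ ^ 2 : ℝ) : ℂ)
      = ((2 * Real.pi * ∑ m ∈ S, ‖a m‖ ^ 2 : ℝ) : ℂ) := by
    rw [← intervalIntegral.integral_ofReal]
    simp only [e]
    rw [intervalIntegral.integral_finsetSum
      fun m _ => Continuous.intervalIntegrable (by fun_prop) _ _]
    rw [Complex.ofReal_mul, Complex.ofReal_sum, Finset.mul_sum]
    refine Finset.sum_congr rfl fun m hm => ?_
    rw [intervalIntegral.integral_finsetSum
      fun m _ => Continuous.intervalIntegrable (by fun_prop) _ _]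
    rw [Finset.sum_eq_single m]
    · rw [intervalIntegral.integral_const_mul, integral_exp_mul_I_zpow, if_pos (by simp),
        Complex.mul_conj']
      push_cast; ring
    · intro k _ hk
      rw [intervalIntegral.integral_const_mul, integral_exp_mul_I_zpow,
        if_neg (by simpa [sub_eq_zero] using fun h => hk h.symm), Complex.ofReal_zero, mul_zero]
    · exact fun h => absurd hm h
  exact_mod_cast h

theorem summable_norm_of_summable_sq {c : ℕ → ℂ} (hc : Summable fun m : ℕ => ((m : ℝ) * ‖c m‖) ^ 2) :
    Summable fun m => ‖c m‖ := by
  have h2 : Summable fun m : ℕ => 1 / (m : ℝ) ^ 2 := Real.summable_one_div_nat_pow.2 one_lt_two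
  refine (h2.add hc).of_norm_bounded_eventually_nat ?_
  filter_upwards [eventually_gt_atTop 0] with m hm
  have hm' : (0 : ℝ) < m := by exact_mod_cast hm
  rw [norm_norm]
  have e : ‖c m‖ = (1 / (m : ℝ)) * (m * ‖c m‖) := by field_simp
  rw [← one_div_pow]
  -- Write `‖c m‖ = (1/m) · (m‖c m‖)` and use `2ab ≤ a² + b²`; both squares are summable.
  nlinarith [sq_nonneg (1 / (m : ℝ) - m * ‖c m‖), sq_nonneg (1 / (m : ℝ)),
    sq_nonneg ((m : ℝ) * ‖c m‖)]

section PowerSeries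

variable {c : ℕ → ℂ}

theorem norm_exp_mul_I_pow (t : ℝ) (m : ℕ) : ‖Complex.exp (t * Complex.I) ^ m‖ = 1 := by
  rw [norm_pow, Complex.norm_exp_ofReal_mul_I, one_pow]

theorem continuousOn_powerSeries (hc : Summable fun m => ‖c m‖) :
    ContinuousOn (fun w : ℂ => ∑' m, c m * w ^ m) (Metric.closedBall 0 1) := by
  refine continuousOn_tsum (fun m => by fun_prop) hc fun m w hw => ?_
  rw [norm_mul, norm_pow]
  exact mul_le_of_le_one_right (norm_nonneg _)
    (pow_le_one₀ (norm_nonneg _) (by simpa using hw))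

theorem continuous_powerSeries_exp (hc : Summable fun m => ‖c m‖) :
    Continuous (fun t : ℝ => ∑' m, c m * Complex.exp (t * Complex.I) ^ m) := by
  refine continuous_tsum (fun m => by fun_prop) hc fun m t => ?_
  rw [norm_mul, norm_exp_mul_I_pow, mul_one]

theorem norm_mul_pow_le_of_mem_ball (c : ℕ → ℂ) (m : ℕ) (w : ℂ)
    (hw : w ∈ Metric.ball (0 : ℂ) 1) : ‖c m * w ^ m‖ ≤ ‖c m‖ := by
  rw [norm_mul, norm_pow]
  exact mul_le_of_le_one_right (norm_nonneg _)
    (pow_le_one₀ (norm_nonneg _) (by simpa using (mem_ball_zero_iff.1 hw).le))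

theorem differentiableOn_powerSeries (hc : Summable fun m => ‖c m‖) :
    DifferentiableOn ℂ (fun w : ℂ => ∑' m, c m * w ^ m) (Metric.ball 0 1) :=
  Complex.differentiableOn_tsum_of_summable_norm hc (fun m => by fun_prop) Metric.isOpen_ball
    (norm_mul_pow_le_of_mem_ball c)

theorem hasSum_mul_deriv_powerSeries (hc : Summable fun m => ‖c m‖) {w : ℂ}
    (hw : w ∈ Metric.ball (0 : ℂ) 1) :
    HasSum (fun m : ℕ => m * c m * w ^ m) (w * deriv (fun w : ℂ => ∑' m, c m * w ^ m) w) := by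
  have h := (Complex.hasSum_deriv_of_summable_norm hc (F := fun m w => c m * w ^ m)
    (fun m => by fun_prop) Metric.isOpen_ball (norm_mul_pow_le_of_mem_ball c) hw).mul_left w
  have e : (fun m : ℕ => m * c m * w ^ m) = fun m => w * deriv (fun w => c m * w ^ m) w := by
    funext m
    rw [deriv_const_mul_field, deriv_pow_field]
    rcases m with _ | m
    · simp
    · simp [pow_succ]; ring
  rw [e]
  exact h

theorem norm_ofReal_mul_exp (r τ : ℝ) (hr : 0 ≤ r) :
    ‖(r : ℂ) * Complex.exp (τ * Complex.I)‖ = r := by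
  rw [norm_mul, Complex.norm_exp_ofReal_mul_I, mul_one, Complex.norm_real, Real.norm_eq_abs,
    abs_of_nonneg hr]

/-- Both sides are the sum of `i m c_m r^m e^{imτ}`; on the right, a bound for the kernel and `∑ ‖c
m‖ < ∞` allow termwise integration. This puts `i w A'(w)` in the form required by Fatou's theorem.
-/
theorem powerSeries_angular_deriv_eq (hc : Summable fun m => ‖c m‖) {r : ℝ} (h0 : 0 ≤ r)
    (h1 : r < 1) (τ : ℝ) :
    Complex.I * ((r * Complex.exp (τ * Complex.I)) *
        deriv (fun w : ℂ => ∑' m, c m * w ^ m) (r * Complex.exp (τ * Complex.I)))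
      = ∫ x in (-Real.pi)..Real.pi, (angularPoisson r x / (2 * Real.pi)) •
          ∑' m, c m * Complex.exp ((τ + x : ℝ) * Complex.I) ^ m := by
  have hQ := continuous_angularPoisson h0 h1
  set Q : ℝ → ℝ := fun x => angularPoisson r x / (2 * Real.pi) with hQdef
  have hQc : Continuous Q := by fun_prop
  have hw : (r : ℂ) * Complex.exp (τ * Complex.I) ∈ Metric.ball (0 : ℂ) 1 := by
    rw [mem_ball_zero_iff, norm_ofReal_mul_exp r τ h0]; exact h1
  have hL := (hasSum_mul_deriv_powerSeries hc hw).mul_left Complex.I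
  have hM : ∀ x : ℝ, Q x • ∑' m, c m * Complex.exp ((τ + x : ℝ) * Complex.I) ^ m
      = ∑' m, Q x • (c m * Complex.exp ((τ + x : ℝ) * Complex.I) ^ m) := by
    intro x
    rw [Summable.tsum_const_smul]
    refine hc.of_norm_bounded fun m => ?_
    rw [norm_mul, norm_exp_mul_I_pow, mul_one]
  obtain ⟨B, hB⟩ : ∃ B, ∀ x, |Q x| ≤ B := by
    have hper : Function.Periodic (fun x => Q x) (2 * Real.pi) := by
      intro x; simp [hQdef, angularPoisson]
    exact exists_norm_le_of_periodic hQc hper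
  have hR := hasSum_intervalIntegral_of_norm_le (u := fun m => B * ‖c m‖) (hc.mul_left B)
    (F := fun m x => Q x • (c m * Complex.exp ((τ + x : ℝ) * Complex.I) ^ m))
    (fun m => by fun_prop) (fun m x => by
      rw [norm_smul, norm_mul, norm_exp_mul_I_pow, mul_one, Real.norm_eq_abs]
      exact mul_le_mul_of_nonneg_right (hB x) (norm_nonneg _)) (-Real.pi) Real.pi
  change _ = ∫ x in (-Real.pi)..Real.pi, Q x •
    ∑' m, c m * Complex.exp ((τ + x : ℝ) * Complex.I) ^ m
  simp only [hM]
  refine hL.unique (hR.congr_fun ?_)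
  intro m
  have e : ∀ x : ℝ, Q x • (c m * Complex.exp ((τ + x : ℝ) * Complex.I) ^ m)
      = (c m * Complex.exp (τ * Complex.I) ^ m / (2 * Real.pi)) *
        ((angularPoisson r x : ℂ) * Complex.exp (x * Complex.I) ^ m) := by
    intro x
    simp only [hQdef, Complex.real_smul]
    push_cast
    rw [add_mul, Complex.exp_add, mul_pow]
    ring
  simp only [e]
  rw [intervalIntegral.integral_const_mul, integral_angularPoisson_mul_exp h0 h1]
  have : (Real.pi : ℂ) ≠ 0 := by exact_mod_cast Real.pi_ne_zero
  rw [mul_pow]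
  field_simp

/-- Orthogonality bounds the derivatives of the partial sums in `L²`, hence in `L¹`, uniformly;
variation is lower semicontinuous under pointwise limits. Bounded variation is used because the
harmonic conjugate of a Lipschitz function need not be Lipschitz. -/
theorem boundedVariationOn_powerSeries_exp
    (hc2 : Summable fun m : ℕ => ((m : ℝ) * ‖c m‖) ^ 2) :
    BoundedVariationOn (fun t : ℝ => ∑' m, c m * Complex.exp (t * Complex.I) ^ m)
      (Icc 0 (2 * Real.pi)) := by
  have hc := summable_norm_of_summable_sq hc2
  set M := ∑' m : ℕ, ((m : ℝ) * ‖c m‖) ^ 2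
  set K : ENNReal := ENNReal.ofReal (Real.pi + Real.pi * M)
  have hS : ∀ N : ℕ, eVariationOn (fun t : ℝ => ∑ m ∈ Finset.range N,
      c m * Complex.exp (t * Complex.I) ^ m) (Icc 0 (2 * Real.pi)) ≤ K := by
    intro N
    set S' : ℝ → ℂ := fun t => ∑ m ∈ Finset.range N,
      (c m * (m * Complex.I)) * Complex.exp (t * Complex.I) ^ m
    have hd : ∀ t : ℝ, HasDerivAt (fun t : ℝ => ∑ m ∈ Finset.range N,
        c m * Complex.exp (t * Complex.I) ^ m) (S' t) t := by
      intro t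
      refine HasDerivAt.fun_sum fun m _ => ?_
      have h := (((Complex.hasDerivAt_exp ((t : ℂ) * Complex.I)).comp t
        ((Complex.ofRealCLM.hasDerivAt (x := t)).mul_const Complex.I)).pow m).const_mul (c m)
      refine h.congr_deriv ?_
      rcases m with _ | m
      · simp
      · simp; ring
    refine (eVariationOn_Icc_le_integral_norm_deriv hd (by fun_prop)
      Real.two_pi_pos.le).trans (ENNReal.ofReal_le_ofReal ?_)
    have hsq := integral_norm_sq_trigPolynomial (fun m => c m * (m * Complex.I)) (Finset.range N)
    have hle : ∑ m ∈ Finset.range N, ‖c m * (m * Complex.I)‖ ^ 2 ≤ M := by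
      have e : ∀ m : ℕ, ‖c m * (m * Complex.I)‖ ^ 2 = ((m : ℝ) * ‖c m‖) ^ 2 := by
        intro m; simp [mul_comm]
      simp only [e]
      exact hc2.sum_le_tsum _ fun m _ => sq_nonneg _
    have hint : Continuous fun t => (1 + ‖S' t‖ ^ 2) / 2 := by fun_prop
    -- The pointwise bound `s ≤ (1 + s²)/2` replaces Cauchy–Schwarz and produces the constant `π +
    -- πM`.
    calc ∫ t in (0 : ℝ)..2 * Real.pi, ‖S' t‖
        ≤ ∫ t in (0 : ℝ)..2 * Real.pi, (1 + ‖S' t‖ ^ 2) / 2 := by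
          refine intervalIntegral.integral_mono_on Real.two_pi_pos.le
            (Continuous.intervalIntegrable (by fun_prop) _ _) (hint.intervalIntegrable _ _) ?_
          intro t _
          nlinarith [sq_nonneg (1 - ‖S' t‖)]
      _ = Real.pi + Real.pi * ∑ m ∈ Finset.range N, ‖c m * (m * Complex.I)‖ ^ 2 := by
          rw [intervalIntegral.integral_div, intervalIntegral.integral_add (by simp)
            (Continuous.intervalIntegrable (by fun_prop) _ _), hsq]
          simp; ring
      _ ≤ _ := by have := Real.pi_pos; gcongr
  have hlim : ∀ t ∈ Icc (0 : ℝ) (2 * Real.pi), Tendsto (fun N : ℕ => ∑ m ∈ Finset.range N,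
      c m * Complex.exp (t * Complex.I) ^ m) atTop
      (𝓝 (∑' m, c m * Complex.exp (t * Complex.I) ^ m)) := by
    intro t _
    refine (Summable.hasSum ?_).tendsto_sum_nat
    refine hc.of_norm_bounded fun m => ?_
    rw [norm_mul, norm_exp_mul_I_pow, mul_one]
  have hle : eVariationOn (fun t : ℝ => ∑' m, c m * Complex.exp (t * Complex.I) ^ m)
      (Icc 0 (2 * Real.pi)) ≤ K := by
    by_contra h
    -- If the limit had variation above `K`, so would some partial sum.
    obtain ⟨N, hN⟩ := (eVariationOn.lowerSemicontinuous_aux hlim (not_le.1 h)).exists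
    exact absurd hN (not_lt.2 (hS N))
  exact ne_top_of_le_ne_top ENNReal.ofReal_ne_top hle

/-- A power series with square summable derivative coefficients has an angular derivative with
radial limits almost everywhere, equal to the derivative of the boundary function. -/
theorem ae_tendsto_powerSeries_angular_deriv
    (hc2 : Summable fun m : ℕ => ((m : ℝ) * ‖c m‖) ^ 2) :
    ∀ᵐ τ : ℝ, τ ∈ Icc 0 (2 * Real.pi) →
      DifferentiableAt ℝ (fun t : ℝ => ∑' m, c m * Complex.exp (t * Complex.I) ^ m) τ ∧
      Tendsto (fun r : ℝ => Complex.I * ((r * Complex.exp (τ * Complex.I)) *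
        deriv (fun w : ℂ => ∑' m, c m * w ^ m) (r * Complex.exp (τ * Complex.I)))) (𝓝[<] 1)
        (𝓝 (deriv (fun t : ℝ => ∑' m, c m * Complex.exp (t * Complex.I) ^ m) τ)) := by
  have hc := summable_norm_of_summable_sq hc2
  have hbv := boundedVariationOn_powerSeries_exp hc2
  rw [← uIcc_of_le Real.two_pi_pos.le] at hbv ⊢
  filter_upwards [hbv.ae_differentiableAt_of_mem_uIcc] with τ hτ hmem
  refine ⟨hτ hmem, (tendsto_integral_angularPoisson (continuous_powerSeries_exp hc)
    (hτ hmem)).congr' ?_⟩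
  filter_upwards [Ioo_mem_nhdsLT (show (0 : ℝ) < 1 by norm_num)] with r hr
  exact (powerSeries_angular_deriv_eq hc hr.1.le hr.2 τ).symm

end PowerSeries

end

/-! ### Fourier coefficients of Lipschitz functions and the holomorphic completion -/

noncomputable section

/-- The Fourier coefficient of order `m ≥ 0` of a function on `[0, 2π]`. -/
def circleCoeff (φ : ℝ → ℂ) (m : ℕ) : ℂ :=
  (2 * Real.pi)⁻¹ * ∫ t in (0 : ℝ)..2 * Real.pi, φ t * Complex.exp (-(t * Complex.I)) ^ m

theorem fourierCoeffOn_eq_circleCoeff (φ : ℝ → ℂ) (m : ℕ) :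
    fourierCoeffOn Real.two_pi_pos φ m = circleCoeff φ m := by
  rw [fourierCoeffOn_eq_integral, circleCoeff, Complex.real_smul]
  congr 1
  · simp
  · refine intervalIntegral.integral_congr fun t _ => ?_
    simp only [fourier_coe_apply, smul_eq_mul]
    rw [mul_comm, ← Complex.exp_nat_mul]
    congr 2
    have : (Real.pi : ℂ) ≠ 0 := by exact_mod_cast Real.pi_ne_zero
    push_cast
    field_simp
    ring

theorem sum_sq_circleCoeff_le {φ : ℝ → ℂ} (hφ : Continuous φ) (S : Finset ℕ) :
    ∑ m ∈ S, ‖circleCoeff φ m‖ ^ 2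
      ≤ (2 * Real.pi)⁻¹ * ∫ t in (0 : ℝ)..2 * Real.pi, ‖φ t‖ ^ 2 := by
  have hL2 : MemLp φ 2 (volume.restrict (Ioc 0 (2 * Real.pi))) := by
    obtain ⟨B, hB⟩ := (isCompact_Icc (a := (0 : ℝ)) (b := 2 * Real.pi)).exists_bound_of_continuousOn
      hφ.continuousOn
    refine MemLp.of_bound hφ.aestronglyMeasurable B ?_
    exact (ae_restrict_mem measurableSet_Ioc).mono fun t ht => hB t (Ioc_subset_Icc_self ht)
  have h := hasSum_sq_fourierCoeffOn Real.two_pi_pos hL2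
  have h2 := sum_le_hasSum (S.map Nat.castEmbedding) (fun _ _ => sq_nonneg _) h
  simpa [fourierCoeffOn_eq_circleCoeff] using h2

theorem circleCoeff_shift_sub {g : ℝ → ℂ} (hg : Continuous g)
    (hper : Function.Periodic g (2 * Real.pi)) (δ : ℝ) (m : ℕ) :
    circleCoeff (fun t => g (t + δ) - g t) m
      = (Complex.exp (δ * Complex.I) ^ m - 1) * circleCoeff g m := by
  have hshift : ∫ t in (0 : ℝ)..2 * Real.pi, g (t + δ) * Complex.exp (-(t * Complex.I)) ^ m
      = Complex.exp (δ * Complex.I) ^ m *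
        ∫ t in (0 : ℝ)..2 * Real.pi, g t * Complex.exp (-(t * Complex.I)) ^ m := by
    have hp : Function.Periodic (fun t : ℝ => g t * Complex.exp (-(t * Complex.I)) ^ m)
        (2 * Real.pi) := by
      intro t
      simp only [hper t]
      congr 2
      push_cast
      rw [add_mul, neg_add, Complex.exp_add, Complex.exp_neg (2 * _ * _),
        Complex.exp_two_pi_mul_I, inv_one, mul_one]
    have h1 := hp.intervalIntegral_add_eq 0 δ
    rw [zero_add] at h1
    rw [h1, ← intervalIntegral.integral_const_mul]
    have h2 := intervalIntegral.integral_comp_add_right (a := 0) (b := 2 * Real.pi)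
      (fun t : ℝ => Complex.exp (δ * Complex.I) ^ m * (g t * Complex.exp (-(t * Complex.I)) ^ m)) δ
    rw [zero_add, add_comm (2 * Real.pi)] at h2
    rw [← h2]
    refine intervalIntegral.integral_congr fun t _ => ?_
    push_cast
    rw [add_mul, neg_add, Complex.exp_add, mul_pow, mul_left_comm (Complex.exp _ ^ m),
      mul_left_comm (Complex.exp _ ^ m), ← mul_pow (Complex.exp (δ * Complex.I)), ← Complex.exp_add]
    simp
  simp only [circleCoeff, sub_mul]
  rw [intervalIntegral.integral_sub (Continuous.intervalIntegrable (by fun_prop) _ _)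
    (Continuous.intervalIntegrable (by fun_prop) _ _), hshift]
  ring

theorem tendsto_exp_pow_sub_one_div (m : ℕ) :
    Tendsto (fun δ : ℝ => ‖Complex.exp (δ * Complex.I) ^ m - 1‖ / |δ|) (𝓝[≠] 0) (𝓝 m) := by
  have hd : HasDerivAt (fun δ : ℝ => Complex.exp (δ * Complex.I) ^ m) (m * Complex.I) 0 := by
    have h := ((Complex.hasDerivAt_exp (((0 : ℝ) : ℂ) * Complex.I)).comp (0 : ℝ)
        ((Complex.ofRealCLM.hasDerivAt (x := (0 : ℝ))).mul_const Complex.I)).pow m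
    refine h.congr_deriv ?_
    simp
  have h := (hasDerivAt_iff_tendsto_slope.1 hd).norm
  have e : ‖(m : ℂ) * Complex.I‖ = m := by simp
  rw [e] at h
  refine h.congr fun δ => ?_
  rw [slope_def_module, norm_smul]
  simp [div_eq_inv_mul]

/-- Parseval bounds the coefficients `(e^{imδ} - 1) c_m` of `g(· + δ) - g` by `L²δ²` in square sum.
Dividing by `δ²` and letting `δ → 0` in each finite sum bounds it by `L²`, with no derivative of `g`
involved. -/
theorem summable_sq_circleCoeff {g : ℝ → ℂ} (hper : Function.Periodic g (2 * Real.pi)) {L : NNReal}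
    (hg : LipschitzWith L g) : Summable fun m : ℕ => ((m : ℝ) * ‖circleCoeff g m‖) ^ 2 := by
  refine summable_of_sum_le (c := (L : ℝ) ^ 2) (fun m => sq_nonneg _) fun S => ?_
  have hlim : Tendsto (fun δ : ℝ => ∑ m ∈ S,
      (‖Complex.exp (δ * Complex.I) ^ m - 1‖ / |δ| * ‖circleCoeff g m‖) ^ 2) (𝓝[≠] 0)
      (𝓝 (∑ m ∈ S, ((m : ℝ) * ‖circleCoeff g m‖) ^ 2)) :=
    tendsto_finsetSum _ fun m _ => ((tendsto_exp_pow_sub_one_div m).mul_const _).pow 2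
  refine le_of_tendsto hlim ?_
  filter_upwards [self_mem_nhdsWithin] with δ hδ
  have hδ' : 0 < |δ| := abs_pos.2 hδ
  have hc := hg.continuous
  have h := sum_sq_circleCoeff_le (φ := fun t => g (t + δ) - g t) (by fun_prop) S
  simp only [circleCoeff_shift_sub hc hper, norm_mul] at h
  have h2 : ∫ t in (0 : ℝ)..2 * Real.pi, ‖g (t + δ) - g t‖ ^ 2
      ≤ ∫ t in (0 : ℝ)..2 * Real.pi, (L * |δ|) ^ 2 := by
    refine intervalIntegral.integral_mono_on Real.two_pi_pos.le
      (Continuous.intervalIntegrable (by fun_prop) _ _) (by simp) fun t _ => ?_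
    have := hg.dist_le_mul (t + δ) t
    rw [dist_eq_norm, dist_eq_norm, add_sub_cancel_left, Real.norm_eq_abs] at this
    gcongr
  have h3 : ∑ m ∈ S, (‖Complex.exp (δ * Complex.I) ^ m - 1‖ * ‖circleCoeff g m‖) ^ 2
      ≤ (L * |δ|) ^ 2 := by
    refine h.trans ?_
    rw [inv_mul_le_iff₀ Real.two_pi_pos]
    simpa using h2
  calc ∑ m ∈ S, (‖Complex.exp (δ * Complex.I) ^ m - 1‖ / |δ| * ‖circleCoeff g m‖) ^ 2
      = (∑ m ∈ S, (‖Complex.exp (δ * Complex.I) ^ m - 1‖ * ‖circleCoeff g m‖) ^ 2) / |δ| ^ 2 := by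
        rw [Finset.sum_div]
        refine Finset.sum_congr rfl fun m _ => ?_
        rw [← div_pow]; ring
    _ ≤ (L * |δ|) ^ 2 / |δ| ^ 2 := by gcongr
    _ = (L : ℝ) ^ 2 := by field_simp

/-- The kernel is the real part of `(ζ + w)/(ζ - w) = 2/(1 - w/ζ) - 1`, a geometric series. -/
theorem poissonKernel_eq_two_re_tsum {w ζ : ℂ} (hw : ‖w‖ < 1) (hζ : ‖ζ‖ = 1) :
    poissonKernel 0 w ζ = 2 * (∑' m : ℕ, w ^ m * (ζ⁻¹) ^ m).re - 1 := by
  have hζ0 : ζ ≠ 0 := fun h => by simp [h] at hζ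
  have hn : ‖w * ζ⁻¹‖ < 1 := by simpa [hζ] using hw
  have hne : ζ - w ≠ 0 := fun h => by
    rw [sub_eq_zero] at h; rw [h] at hζ; linarith
  simp only [← mul_pow]
  rw [tsum_geometric_of_norm_lt_one hn, poissonKernel_eq_re_herglotzRieszKernel,
    Function.comp_apply, herglotzRieszKernel_def]
  have e : (ζ - 0 + (w - 0)) / (ζ - 0 - (w - 0)) = (2 : ℝ) * (1 - w * ζ⁻¹)⁻¹ - 1 := by
    have h1 : 1 - w * ζ⁻¹ = (ζ - w) / ζ := by field_simp
    rw [h1, inv_div, sub_zero, sub_zero, eq_sub_iff_add_eq, div_add_one hne]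
    push_cast
    ring
  rw [e, Complex.sub_re, Complex.re_ofReal_mul, Complex.one_re]

/-- Integrate the geometric expansion termwise. Doubling the real part counts the zeroth coefficient
twice, so the mean of `g` is subtracted. -/
theorem poissonIntegral_eq_two_re_powerSeries {g : ℝ → ℝ} (hg : Continuous g) {w : ℂ}
    (hw : ‖w‖ < 1) :
    ∫ t in (0 : ℝ)..2 * Real.pi, poissonKernel 0 w (Circle.exp t : ℂ) / (2 * Real.pi) * g t
      = 2 * (∑' m, circleCoeff (fun t => (g t : ℂ)) m * w ^ m).re
        - (2 * Real.pi)⁻¹ * ∫ t in (0 : ℝ)..2 * Real.pi, g t := by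
  obtain ⟨B, hB⟩ := (isCompact_Icc (a := (0 : ℝ)) (b := 2 * Real.pi)).exists_bound_of_continuousOn
    hg.continuousOn
  have hinv : ∀ t : ℝ, (Circle.exp t : ℂ)⁻¹ = Complex.exp (-(t * Complex.I)) := by
    intro t; rw [Circle.coe_exp, Complex.exp_neg]
  have hgeo : Summable fun m : ℕ => ‖w‖ ^ m := summable_geometric_of_lt_one (norm_nonneg _) hw
  have hnorm : ∀ t : ℝ, ‖Complex.exp (-(t * Complex.I))‖ = 1 := by
    intro t
    have := Complex.norm_exp_ofReal_mul_I (-t)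
    push_cast at this
    rwa [neg_mul] at this
  have hsum : ∀ t : ℝ, Summable fun m : ℕ => w ^ m * Complex.exp (-(t * Complex.I)) ^ m := by
    intro t
    refine hgeo.of_norm_bounded fun m => ?_
    rw [norm_mul, norm_pow, norm_pow, hnorm, one_pow, mul_one]
  have hcont : Continuous fun t : ℝ => ∑' m : ℕ, w ^ m * Complex.exp (-(t * Complex.I)) ^ m := by
    refine continuous_tsum (fun m => by fun_prop) hgeo fun m t => ?_
    rw [norm_mul, norm_pow, norm_pow, hnorm, one_pow, mul_one]
  have hI : HasSum (fun m : ℕ => circleCoeff (fun t => (g t : ℂ)) m * w ^ m)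
      (∫ t in (0 : ℝ)..2 * Real.pi, ((2 * Real.pi)⁻¹ * g t : ℝ) •
        ∑' m : ℕ, w ^ m * Complex.exp (-(t * Complex.I)) ^ m) := by
    have h := intervalIntegral.hasSum_integral_of_dominated_convergence (μ := volume)
      (a := 0) (b := 2 * Real.pi)
      (F := fun m t => ((2 * Real.pi)⁻¹ * g t : ℝ) •
        (w ^ m * Complex.exp (-(t * Complex.I)) ^ m))
      (f := fun t => ((2 * Real.pi)⁻¹ * g t : ℝ) •
        ∑' m : ℕ, w ^ m * Complex.exp (-(t * Complex.I)) ^ m)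
      (fun m _ => (2 * Real.pi)⁻¹ * B * ‖w‖ ^ m)
      (fun m => (Continuous.aestronglyMeasurable (by fun_prop)))
      (fun m => ae_of_all _ fun t ht => ?_) (ae_of_all _ fun t _ => hgeo.mul_left _) (by simp)
      (ae_of_all _ fun t _ => (hsum t).hasSum.const_smul _)
    · refine h.congr_fun fun m => ?_
      rw [circleCoeff, mul_assoc, mul_comm _ (w ^ m), ← mul_assoc,
        ← intervalIntegral.integral_const_mul]
      refine intervalIntegral.integral_congr fun t _ => ?_
      simp only [Complex.real_smul]
      push_cast; ring
    · rw [uIoc_of_le Real.two_pi_pos.le] at ht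
      rw [norm_smul, norm_mul, norm_mul, norm_pow, norm_pow, hnorm, one_pow, mul_one, norm_inv,
        Real.norm_of_nonneg Real.two_pi_pos.le]
      have := hB t (Ioc_subset_Icc_self ht)
      have := Real.two_pi_pos
      gcongr
  rw [hI.tsum_eq]
  have hre := Complex.reCLM.intervalIntegral_comp_comm (μ := volume) (a := 0) (b := 2 * Real.pi)
    (f := fun t => ((2 * Real.pi)⁻¹ * g t : ℝ) •
        ∑' m : ℕ, w ^ m * Complex.exp (-(t * Complex.I)) ^ m)
    (Continuous.intervalIntegrable (by fun_prop) _ _)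
  simp only [Complex.reCLM_apply, Complex.smul_re, smul_eq_mul] at hre
  rw [← hre, ← intervalIntegral.integral_const_mul, ← intervalIntegral.integral_const_mul,
    ← intervalIntegral.integral_sub]
  · refine intervalIntegral.integral_congr fun t _ => ?_
    rw [poissonKernel_eq_two_re_tsum hw (Circle.norm_coe _), hinv]
    ring
  · exact Continuous.intervalIntegrable (by fun_prop) _ _
  · exact Continuous.intervalIntegrable (by fun_prop) _ _

theorem poissonIntegral_eq_radial {E : Type*} [NormedAddCommGroup E] [NormedSpace ℝ E]
    {g : ℝ → E} (hper : Function.Periodic g (2 * Real.pi)) (r τ : ℝ) :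
    ∫ t in (0 : ℝ)..2 * Real.pi,
        (poissonKernel 0 ((r : ℂ) * (Circle.exp τ : ℂ)) (Circle.exp t : ℂ) / (2 * Real.pi)) • g t
      = ∫ x in (-Real.pi)..Real.pi, (radialPoisson r x / (2 * Real.pi)) • g (τ + x) := by
  simp only [poissonKernel_eq_radialPoisson]
  rw [integral_shift_of_periodic _ τ]
  · simp
  · intro t
    simp only [hper t]
    rw [add_sub_right_comm, radialPoisson_periodic]

/-- The gradient of the Poisson integral of a periodic Lipschitz function: it is given by a
holomorphic function `A`, and it has radial limits almost everywhere on the circle. -/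
theorem exists_holomorphic_of_lipschitz {g : ℝ → ℝ} (hper : Function.Periodic g (2 * Real.pi))
    {L : NNReal} (hg : LipschitzWith L g) :
    ∃ (A : ℂ → ℂ) (c₀ : ℝ), DifferentiableOn ℂ A (Metric.ball 0 1) ∧
      (∀ w : ℂ, ‖w‖ < 1 →
        ∫ t in (0 : ℝ)..2 * Real.pi, poissonKernel 0 w (Circle.exp t : ℂ) / (2 * Real.pi) * g t
          = 2 * (A w).re - c₀) ∧
      ∀ᵐ τ : ℝ, τ ∈ Icc 0 (2 * Real.pi) → ∃ α : ℂ, HasDerivAt g (2 * α.re) τ ∧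
        Tendsto (fun r : ℝ => Complex.I * ((r * (Circle.exp τ : ℂ)) *
          deriv A (r * (Circle.exp τ : ℂ)))) (𝓝[<] 1) (𝓝 α) := by
  have hgC : LipschitzWith L (fun t => (g t : ℂ)) := by
    have := Complex.isometry_ofReal.lipschitz.comp hg
    rwa [one_mul] at this
  have hperC : Function.Periodic (fun t => (g t : ℂ)) (2 * Real.pi) := fun t => by
    simp only [hper t]
  have hc2 := summable_sq_circleCoeff hperC hgC
  have hc := summable_norm_of_summable_sq hc2
  set c := circleCoeff fun t => (g t : ℂ)
  set c₀ := (2 * Real.pi)⁻¹ * ∫ t in (0 : ℝ)..2 * Real.pi, g t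
  -- The identity persists on the circle: along a radius the Poisson integral tends to `g t`, while
  -- absolute summability makes the series continuous on the closed disk.
  have hbdry : ∀ t, g t = 2 * (∑' m, c m * Complex.exp (t * Complex.I) ^ m).re - c₀ := by
    intro t
    have h1 : Tendsto (fun r : ℝ => ∑' m, c m * (r * Complex.exp (t * Complex.I)) ^ m) (𝓝[<] 1)
        (𝓝 (∑' m, c m * Complex.exp (t * Complex.I) ^ m)) := by
      have hcw := (continuousOn_powerSeries hc) (Complex.exp (t * Complex.I))
        (by simp [Complex.norm_exp_ofReal_mul_I])
      refine hcw.tendsto.comp (tendsto_nhdsWithin_iff.2 ⟨?_, ?_⟩)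
      · have : Continuous fun r : ℝ => (r : ℂ) * Complex.exp (t * Complex.I) := by fun_prop
        simpa using (this.tendsto 1).mono_left nhdsWithin_le_nhds
      · filter_upwards [Ioo_mem_nhdsLT (show (0 : ℝ) < 1 by norm_num)] with r hr
        rw [mem_closedBall_zero_iff, norm_ofReal_mul_exp r t hr.1.le]
        exact hr.2.le
    have h2 := ((Complex.continuous_re.tendsto _).comp h1).const_mul 2 |>.sub_const c₀
    refine tendsto_nhds_unique (tendsto_integral_radialPoisson hg.continuous t) (h2.congr' ?_)
    filter_upwards [Ioo_mem_nhdsLT (show (0 : ℝ) < 1 by norm_num)] with r hr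
    have hw : ‖(r : ℂ) * Complex.exp (t * Complex.I)‖ < 1 := by
      rw [norm_ofReal_mul_exp r t hr.1.le]; exact hr.2
    have h3 := poissonIntegral_eq_two_re_powerSeries hg.continuous hw
    have h4 := poissonIntegral_eq_radial hper r t
    rw [Circle.coe_exp] at h4
    simp only [smul_eq_mul] at h4
    simp only [smul_eq_mul]
    rw [← h4, h3]
    rfl
  refine ⟨fun w => ∑' m, c m * w ^ m, c₀, differentiableOn_powerSeries hc,
    fun w hw => poissonIntegral_eq_two_re_powerSeries hg.continuous hw, ?_⟩
  filter_upwards [ae_tendsto_powerSeries_angular_deriv hc2] with τ hτ hmem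
  obtain ⟨hd, hl⟩ := hτ hmem
  refine ⟨_, ?_, hl⟩
  have h := ((Complex.reCLM.hasFDerivAt.comp_hasDerivAt τ hd.hasDerivAt).const_mul 2).sub_const c₀
  refine h.congr_of_eventuallyEq (Eventually.of_forall fun t => ?_)
  exact hbdry t

end

/-! ### Parallelogram area as the norm of a linear map -/

noncomputable section

/-- The area of the parallelogram spanned by two vectors. -/
def gramArea {E : Type*} [NormedAddCommGroup E] [InnerProductSpace ℝ E] (a b : E) : ℝ :=
  √(‖a‖ ^ 2 * ‖b‖ ^ 2 - inner ℝ a b ^ 2)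

section GramArea

variable {E : Type*} [NormedAddCommGroup E] [InnerProductSpace ℝ E]

/-- The linear map `a ↦ |b| (a - proj_b a)`, whose norm at `a` is `gramArea a b`. -/
def gramMap (b : E) : E →L[ℝ] E :=
  ‖b‖ • ContinuousLinearMap.id ℝ E - (‖b‖⁻¹ • innerSL ℝ b).smulRight b

/-- Linearity in `a` is what lets the area be estimated under an integral sign. For `b = 0` both
sides vanish. -/
theorem gramArea_eq_norm_gramMap (a b : E) : gramArea a b = ‖gramMap b a‖ := by
  have h : ‖gramMap b a‖ ^ 2 = ‖a‖ ^ 2 * ‖b‖ ^ 2 - inner ℝ a b ^ 2 := by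
    rcases eq_or_ne b 0 with rfl | hb
    · simp [gramMap]
    · have hb' : ‖b‖ ≠ 0 := norm_ne_zero_iff.2 hb
      have e : gramMap b a = ‖b‖ • a - (‖b‖⁻¹ * inner ℝ b a) • b := by simp [gramMap]
      rw [e, @norm_sub_sq_real, norm_smul, norm_smul, inner_smul_left, inner_smul_right,
        real_inner_comm b a]
      simp only [Real.norm_eq_abs, mul_pow, sq_abs, conj_trivial]
      field_simp
      ring
  rw [gramArea, ← h, Real.sqrt_sq (norm_nonneg _)]

theorem gramArea_nonneg (a b : E) : 0 ≤ gramArea a b := Real.sqrt_nonneg _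

theorem gramArea_comm (a b : E) : gramArea a b = gramArea b a := by
  rw [gramArea, gramArea, real_inner_comm, mul_comm]

theorem gramArea_smul_left (c : ℝ) (a b : E) : gramArea (c • a) b = |c| * gramArea a b := by
  simp [gramArea_eq_norm_gramMap, norm_smul]

theorem gramArea_smul_right (c : ℝ) (a b : E) : gramArea a (c • b) = |c| * gramArea a b := by
  rw [gramArea_comm, gramArea_smul_left, gramArea_comm]

theorem gramArea_le_mul (a b : E) : gramArea a b ≤ ‖a‖ * ‖b‖ := by
  rw [gramArea]
  refine Real.sqrt_le_iff.2 ⟨by positivity, ?_⟩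
  nlinarith [sq_nonneg (inner ℝ a b : ℝ)]

theorem gramArea_sub_smul_left (a b : E) (c : ℝ) : gramArea (a - c • b) b = gramArea a b := by
  have h : gramMap b b = 0 := by
    have : gramArea b b = 0 := by simp [gramArea]; ring_nf; simp
    rwa [gramArea_eq_norm_gramMap, norm_eq_zero] at this
  rw [gramArea_eq_norm_gramMap, map_sub, map_smul, h, smul_zero, sub_zero,
    gramArea_eq_norm_gramMap]

theorem continuous_gramArea : Continuous fun p : E × E => gramArea p.1 p.2 := by
  unfold gramArea
  fun_prop

theorem gramArea_rotate (a b : E) {c s : ℝ} (h : c ^ 2 + s ^ 2 = 1) :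
    gramArea (c • a + s • b) (-s • a + c • b) = gramArea a b := by
  unfold gramArea
  congr 1
  have h1 : ‖c • a + s • b‖ ^ 2 = c ^ 2 * ‖a‖ ^ 2 + 2 * c * s * inner ℝ a b + s ^ 2 * ‖b‖ ^ 2 := by
    rw [@norm_add_sq_real, norm_smul, norm_smul, inner_smul_left, inner_smul_right]
    simp [mul_pow]; ring
  have h2 : ‖-s • a + c • b‖ ^ 2
      = s ^ 2 * ‖a‖ ^ 2 - 2 * c * s * inner ℝ a b + c ^ 2 * ‖b‖ ^ 2 := by
    rw [@norm_add_sq_real, norm_smul, norm_smul, inner_smul_left, inner_smul_right]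
    simp [mul_pow]; ring
  have h3 : inner ℝ (c • a + s • b) (-s • a + c • b)
      = -(c * s) * ‖a‖ ^ 2 + (c ^ 2 - s ^ 2) * inner ℝ a b + c * s * ‖b‖ ^ 2 := by
    simp only [inner_add_left, inner_add_right, inner_smul_left, inner_smul_right,
      real_inner_self_eq_norm_sq, real_inner_comm a b, conj_trivial]
    ring
  rw [h1, h2, h3]
  -- The Gram determinant is multiplied by `(c² + s²)²`, and `X² - 1 = (X + 1)(X - 1)`.
  linear_combination (‖a‖ ^ 2 * ‖b‖ ^ 2 - inner ℝ a b ^ 2) * (c ^ 2 + s ^ 2 + 1) * h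

end GramArea

/-! ### Boundary limits of the gradient and of the Jacobian -/

variable {n : ℕ}

theorem circleLift_periodic (F : Circle → EucSpace n) :
    Function.Periodic (circleLift F) (2 * Real.pi) := fun t => by
  simp [circleLift, Circle.exp_add]

theorem surfaceJacobian_eq_gramArea (u : ℂ → EucSpace n) (z : ℂ) (τ : ℝ) :
    surfaceJacobian u z = gramArea (fderiv ℝ u z (Circle.exp τ : ℂ))
      (fderiv ℝ u z (Complex.I * (Circle.exp τ : ℂ))) := by
  have he : (Circle.exp τ : ℂ) = Real.cos τ • (1 : ℂ) + Real.sin τ • Complex.I := by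
    rw [Circle.coe_exp, Complex.exp_mul_I]; simp
  have hie : Complex.I * (Circle.exp τ : ℂ)
      = -Real.sin τ • (1 : ℂ) + Real.cos τ • Complex.I := by
    rw [he]
    simp only [Complex.real_smul]
    push_cast
    linear_combination (Complex.sin τ) * Complex.I_mul_I
  rw [hie, he]
  simp only [map_add, map_smul]
  rw [gramArea_rotate _ _ (Real.cos_sq_add_sin_sq τ)]
  rfl

theorem poissonExtension_radial (F : Circle → EucSpace n) (r τ : ℝ) :
    poissonExtension F ((r : ℂ) * (Circle.exp τ : ℂ))
      = ∫ x in (-Real.pi)..Real.pi, (radialPoisson r x / (2 * Real.pi)) • circleLift F (τ + x) :=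
  poissonIntegral_eq_radial (circleLift_periodic F) r τ

theorem tendsto_poissonExtension {F : Circle → EucSpace n} (hF : Continuous (circleLift F))
    (τ : ℝ) :
    Tendsto (fun r : ℝ => poissonExtension F ((r : ℂ) * (Circle.exp τ : ℂ))) (𝓝[<] 1)
      (𝓝 (circleLift F τ)) := by
  simp only [poissonExtension_radial]
  exact tendsto_integral_radialPoisson hF τ

theorem continuous_poissonKernel_exp {w : ℂ} (hw : ‖w‖ < 1) :
    Continuous fun t : ℝ => poissonKernel 0 w (Circle.exp t : ℂ) := by
  unfold poissonKernel
  refine Continuous.div (by fun_prop) (by fun_prop) fun t => ?_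
  rw [sub_zero, sub_zero]
  refine pow_ne_zero 2 (norm_ne_zero_iff.2 fun h => ?_)
  rw [sub_eq_zero] at h
  rw [← h, Circle.norm_coe] at hw
  exact lt_irrefl _ hw

theorem poissonExtension_apply {F : Circle → EucSpace n} (hF : Continuous (circleLift F)) {w : ℂ}
    (hw : ‖w‖ < 1) (j : Fin n) :
    poissonExtension F w j = ∫ t in (0 : ℝ)..2 * Real.pi,
      poissonKernel 0 w (Circle.exp t : ℂ) / (2 * Real.pi) * circleLift F t j := by
  have hk := continuous_poissonKernel_exp hw
  have hF' : Continuous fun t => F (Circle.exp t) := hF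
  have h := (EuclideanSpace.proj (𝕜 := ℝ) j).intervalIntegral_comp_comm (μ := volume)
    (a := 0) (b := 2 * Real.pi)
    (f := fun t => (poissonKernel 0 w (Circle.exp t : ℂ) / (2 * Real.pi)) • F (Circle.exp t))
    (Continuous.intervalIntegrable ((hk.div_const _).smul hF') _ _)
  rw [poissonExtension]
  exact h.symm

theorem tendsto_of_tendsto_apply {ι : Type*} {l : Filter ι} {f : ι → EucSpace n} {a : EucSpace n}
    (h : ∀ j, Tendsto (fun i => f i j) l (𝓝 (a j))) : Tendsto f l (𝓝 a) :=
  ((PiLp.continuous_toLp 2 fun _ : Fin n => ℝ).tendsto (WithLp.ofLp a)).comp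
    (tendsto_pi_nhds.2 h)

/-- The Poisson extension of a Lipschitz map has radial limits of its gradient almost
everywhere. -/
theorem ae_tendsto_fderiv_poissonExtension {F : Circle → EucSpace n} {L : NNReal}
    (hF : LipschitzWith L (circleLift F)) :
    (∀ w : ℂ, ‖w‖ < 1 → DifferentiableAt ℝ (poissonExtension F) w) ∧
    ∀ᵐ τ : ℝ, τ ∈ Icc 0 (2 * Real.pi) → DifferentiableAt ℝ (circleLift F) τ ∧ ∃ G : EucSpace n,
      Tendsto (fun r : ℝ => fderiv ℝ (poissonExtension F) (r * (Circle.exp τ : ℂ))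
        (Circle.exp τ : ℂ)) (𝓝[<] 1) (𝓝 G) ∧
      Tendsto (fun r : ℝ => fderiv ℝ (poissonExtension F) (r * (Circle.exp τ : ℂ))
        (Complex.I * (Circle.exp τ : ℂ))) (𝓝[<] 1) (𝓝 (deriv (circleLift F) τ)) := by
  have hcoord : ∀ j : Fin n, LipschitzWith L fun t => circleLift F t j := by
    intro j
    refine LipschitzWith.of_dist_le_mul fun s t => ?_
    refine le_trans ?_ (hF.dist_le_mul s t)
    rw [dist_eq_norm, dist_eq_norm]
    exact PiLp.norm_apply_le (circleLift F s - circleLift F t) j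
  have hper : ∀ j : Fin n, Function.Periodic (fun t => circleLift F t j) (2 * Real.pi) :=
    fun j t => by simp only [circleLift_periodic F t]
  choose A c₀ hA hU hae using fun j => exists_holomorphic_of_lipschitz (hper j) (hcoord j)
  -- The derivative of `2 Re A` in direction `v` is `2 Re (A'(w) v)`, so every directional
  -- derivative is read off the single number `A'(w)`.
  have hfd : ∀ w : ℂ, ‖w‖ < 1 → ∀ j, HasFDerivAt (fun w => poissonExtension F w j)
      ((2 : ℝ) • Complex.reCLM.comp
        ((deriv (A j) w • (1 : ℂ →L[ℂ] ℂ)).restrictScalars ℝ)) w := by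
    intro w hw j
    have hwb : Metric.ball (0 : ℂ) 1 ∈ 𝓝 w :=
      Metric.isOpen_ball.mem_nhds (mem_ball_zero_iff.2 hw)
    have h1 : HasFDerivAt (A j) ((deriv (A j) w • (1 : ℂ →L[ℂ] ℂ)).restrictScalars ℝ) w := by
      have := ((hA j).differentiableAt hwb).hasDerivAt.complexToReal_fderiv
      exact this
    have h2 := ((Complex.reCLM.hasFDerivAt.comp w h1).const_mul 2).sub_const (c₀ j)
    refine h2.congr_of_eventuallyEq ?_
    filter_upwards [hwb] with z hz
    rw [mem_ball_zero_iff] at hz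
    rw [poissonExtension_apply hF.continuous hz, hU j z hz]
    rfl
  have hdiff : ∀ w : ℂ, ‖w‖ < 1 → DifferentiableAt ℝ (poissonExtension F) w := fun w hw =>
    differentiableAt_euclidean.2 fun j => (hfd w hw j).differentiableAt
  have hval : ∀ w : ℂ, ‖w‖ < 1 → ∀ v : ℂ, ∀ j,
      fderiv ℝ (poissonExtension F) w v j = 2 * (deriv (A j) w * v).re := by
    intro w hw v j
    have h1 := ((EuclideanSpace.proj (𝕜 := ℝ) j).hasFDerivAt.comp w (hdiff w hw).hasFDerivAt)
    have h2 := h1.unique (hfd w hw j)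
    have h3 := congrArg (fun T => T v) h2
    simpa using h3
  refine ⟨hdiff, ?_⟩
  filter_upwards [ae_all_iff.2 hae] with τ hτ hmem
  choose α hα hlim using fun j => hτ j hmem
  have hd : DifferentiableAt ℝ (circleLift F) τ :=
    differentiableAt_euclidean.2 fun j => (hα j).differentiableAt
  have hdj : ∀ j, deriv (circleLift F) τ j = 2 * (α j).re := fun j =>
    ((EuclideanSpace.proj (𝕜 := ℝ) j).hasFDerivAt.comp_hasDerivAt τ hd.hasDerivAt).unique (hα j)
  have hr : Tendsto (fun r : ℝ => ((r⁻¹ : ℝ) : ℂ)) (𝓝[<] 1) (𝓝 1) := by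
    have h1 : Tendsto (fun r : ℝ => r⁻¹) (𝓝[<] 1) (𝓝 1) := by
      simpa using ((continuousAt_inv₀ (one_ne_zero (α := ℝ))).tendsto).mono_left
        (nhdsWithin_le_nhds (s := Iio 1))
    have h2 := (Complex.continuous_ofReal.tendsto 1).comp h1
    rwa [Complex.ofReal_one] at h2
  -- The known limit is that of `i w A'(w)` at `w = r e^{iτ}`. After division by `r`, the factor `β
  -- = 1` gives the angular derivative and `β = -i` the radial one.
  have hmul : ∀ (β : ℂ) (j : Fin n), Tendsto (fun r : ℝ => 2 * (β * (((r⁻¹ : ℝ) : ℂ) *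
      (Complex.I * ((r * (Circle.exp τ : ℂ)) * deriv (A j) (r * (Circle.exp τ : ℂ)))))).re) (𝓝[<] 1)
      (𝓝 (2 * (β * α j).re)) := by
    intro β j
    have := ((Complex.continuous_re.tendsto _).comp ((hr.mul (hlim j)).const_mul β)).const_mul 2
    rwa [one_mul] at this
  refine ⟨hd, WithLp.toLp 2 fun j => 2 * (-Complex.I * α j).re,
    tendsto_of_tendsto_apply fun j => (hmul (-Complex.I) j).congr' ?_,
    tendsto_of_tendsto_apply fun j => ?_⟩
  · filter_upwards [Ioo_mem_nhdsLT (show (0 : ℝ) < 1 by norm_num)] with r hr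
    rw [hval _ (by rw [Circle.coe_exp, norm_ofReal_mul_exp r τ hr.1.le]; exact hr.2)]
    have : (r : ℂ) ≠ 0 := by exact_mod_cast hr.1.ne'
    congr 2
    generalize deriv (A j) (r * (Circle.exp τ : ℂ)) = d
    generalize (Circle.exp τ : ℂ) = e
    push_cast
    field_simp
    linear_combination (-d * e) * Complex.I_sq
  · rw [hdj, ← one_mul (α j)]
    refine (hmul 1 j).congr' ?_
    filter_upwards [Ioo_mem_nhdsLT (show (0 : ℝ) < 1 by norm_num)] with r hr
    rw [hval _ (by rw [Circle.coe_exp, norm_ofReal_mul_exp r τ hr.1.le]; exact hr.2)]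
    have : (r : ℂ) ≠ 0 := by exact_mod_cast hr.1.ne'
    congr 2
    push_cast
    field_simp

/-- If the radial derivative of a Poisson extension has a limit at a boundary point, then so does
the radial difference quotient. -/
theorem tendsto_radial_quotient {F : Circle → EucSpace n} (hF : Continuous (circleLift F))
    (hu : ∀ w : ℂ, ‖w‖ < 1 → DifferentiableAt ℝ (poissonExtension F) w) {τ : ℝ} {G : EucSpace n}
    (hG : Tendsto (fun r : ℝ => fderiv ℝ (poissonExtension F) (r * (Circle.exp τ : ℂ))
        (Circle.exp τ : ℂ)) (𝓝[<] 1) (𝓝 G)) :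
    Tendsto (fun r : ℝ => (1 - r)⁻¹ • (circleLift F τ -
      poissonExtension F ((r : ℂ) * (Circle.exp τ : ℂ)))) (𝓝[<] 1) (𝓝 G) := by
  classical
  set R : ℝ → EucSpace n := fun r => poissonExtension F ((r : ℂ) * (Circle.exp τ : ℂ)) with hR
  -- Giving the radial function its boundary value at `1` makes it left continuous there, so a limit
  -- of its derivative is a one-sided derivative at the endpoint.
  set R' := Function.update R 1 (circleLift F τ)
  have hRd : ∀ r ∈ Ioo (0 : ℝ) 1, HasDerivAt R' (fderiv ℝ (poissonExtension F)
      (r * (Circle.exp τ : ℂ)) (Circle.exp τ : ℂ)) r := by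
    intro r hr
    have hw : ‖(r : ℂ) * (Circle.exp τ : ℂ)‖ < 1 := by
      rw [Circle.coe_exp, norm_ofReal_mul_exp r τ hr.1.le]; exact hr.2
    have h1 : HasDerivAt (fun r : ℝ => (r : ℂ) * (Circle.exp τ : ℂ)) (Circle.exp τ : ℂ) r := by
      simpa using (Complex.ofRealCLM.hasDerivAt (x := r)).mul_const (Circle.exp τ : ℂ)
    have h2 := HasFDerivAt.comp_hasDerivAt r (hu _ hw).hasFDerivAt h1
    refine h2.congr_of_eventuallyEq ?_
    filter_upwards [Iio_mem_nhds hr.2] with s hs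
    exact Function.update_of_ne hs.ne _ _
  have hmem : Ioo (0 : ℝ) 1 ∈ 𝓝[<] (1 : ℝ) := Ioo_mem_nhdsLT (by norm_num)
  have h := hasDerivWithinAt_Iic_of_tendsto_deriv (f := R') (e := G) (s := Ioo 0 1)
    (fun r hr => (hRd r hr).differentiableAt.differentiableWithinAt) ?_ hmem ?_
  · have h2 := (hasDerivWithinAt_iff_tendsto_slope.1 h)
    have h3 : Iic (1 : ℝ) \ {1} = Iio 1 := Iic_sdiff_right
    rw [h3] at h2
    refine h2.congr' ?_
    filter_upwards [self_mem_nhdsWithin] with r hr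
    have e1 : R' r = R r := Function.update_of_ne (ne_of_lt (mem_Iio.1 hr)) _ _
    have e2 : R' 1 = circleLift F τ := Function.update_self _ _ _
    rw [slope_comm, slope_def_module, e1, e2]
  · rw [continuousWithinAt_update_same]
    exact (tendsto_poissonExtension hF τ).mono_left (nhdsWithin_mono _ fun r hr => hr.1.2)
  · refine hG.congr' ?_
    filter_upwards [hmem] with r hr using (hRd r hr).deriv.symm

/-- The factor `1 - r` of `1 - r²` cancels, and the denominator `(1-r)² + 4r sin²(x/2)` loses its
first term. At `x = 0` the right side is `k / 0 = 0`, hence the condition on `k` there. -/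
theorem poissonKernel_mul_le {r x k : ℝ} (h0 : 0 < r) (h1 : r < 1) (hx : |x| ≤ Real.pi)
    (hk : 0 ≤ k) (hk0 : x = 0 → k = 0) :
    (1 - r)⁻¹ * (radialPoisson r x / (2 * Real.pi) * k)
      ≤ (1 + r) / (2 * r) * (k / (4 * Real.pi * Real.sin (x / 2) ^ 2)) := by
  rcases eq_or_ne x 0 with h | h
  · simp [hk0 h]
  have hs : 0 < Real.sin (x / 2) ^ 2 := by
    refine lt_of_lt_of_le ?_ (sq_div_pi_le_sin_half_sq hx)
    have := Real.pi_ne_zero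
    positivity
  have hπ := Real.pi_pos
  have h1r : 0 < 1 - r := by linarith
  have hD : 4 * r * Real.sin (x / 2) ^ 2 ≤ 1 - 2 * r * Real.cos x + r ^ 2 := by
    rw [poisson_denom_eq]; nlinarith [sq_nonneg (1 - r)]
  calc (1 - r)⁻¹ * (radialPoisson r x / (2 * Real.pi) * k)
      = (1 + r) / (1 - 2 * r * Real.cos x + r ^ 2) / (2 * Real.pi) * k := by
        unfold radialPoisson
        have := poisson_denom_pos h0.le h1 x
        field_simp
        ring
    _ ≤ (1 + r) / (4 * r * Real.sin (x / 2) ^ 2) / (2 * Real.pi) * k := by gcongr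
    _ = _ := by field_simp

/-- The norm of an integral is at most the integral of norms, applied to `gramMap b`; then the
kernel bound is inserted and its factor `(1+r)/(2r)` tends to one. -/
theorem gramArea_limit_le_integral {F : Circle → EucSpace n} (hF : Continuous (circleLift F))
    {τ : ℝ} {G b : EucSpace n}
    (hG : Tendsto (fun r : ℝ => (1 - r)⁻¹ • (circleLift F τ -
      poissonExtension F ((r : ℂ) * (Circle.exp τ : ℂ)))) (𝓝[<] 1) (𝓝 G))
    (hint : IntervalIntegrable (fun x => gramArea (circleLift F (τ + x) - circleLift F τ) b /
      (4 * Real.pi * Real.sin (x / 2) ^ 2)) volume (-Real.pi) Real.pi) :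
    gramArea G b ≤ ∫ x in (-Real.pi)..Real.pi,
      gramArea (circleLift F (τ + x) - circleLift F τ) b /
        (4 * Real.pi * Real.sin (x / 2) ^ 2) := by
  have hπ : -Real.pi ≤ Real.pi := by linarith [Real.pi_pos]
  set K := ∫ x in (-Real.pi)..Real.pi, gramArea (circleLift F (τ + x) - circleLift F τ) b /
        (4 * Real.pi * Real.sin (x / 2) ^ 2)
  have hlim1 : Tendsto (fun r : ℝ => gramArea ((1 - r)⁻¹ • (circleLift F τ -
      poissonExtension F ((r : ℂ) * (Circle.exp τ : ℂ)))) b) (𝓝[<] 1) (𝓝 (gramArea G b)) := by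
    have hc : Continuous fun a : EucSpace n => gramArea a b :=
      continuous_gramArea.comp (continuous_id.prodMk continuous_const)
    exact (hc.tendsto G).comp hG
  have hlim2 : Tendsto (fun r : ℝ => (1 + r) / (2 * r) * K) (𝓝[<] 1) (𝓝 K) := by
    have hc : ContinuousAt (fun r : ℝ => (1 + r) / (2 * r) * K) 1 :=
      (ContinuousAt.div (by fun_prop) (by fun_prop) (by norm_num)).mul continuousAt_const
    have := hc.tendsto.mono_left (nhdsWithin_le_nhds (s := Iio 1))
    norm_num at this
    exact this
  refine le_of_tendsto_of_tendsto hlim1 hlim2 ?_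
  filter_upwards [Ioo_mem_nhdsLT (show (0 : ℝ) < 1 by norm_num)] with r hr
  have hP := continuous_radialPoisson hr.1.le hr.2
  have h1r : 0 < 1 - r := by linarith [hr.2]
  -- The Poisson kernel has mass one, so `F(τ)` can be taken inside the integral.
  have e1 : circleLift F τ - poissonExtension F ((r : ℂ) * (Circle.exp τ : ℂ))
      = -∫ x in (-Real.pi)..Real.pi, (radialPoisson r x / (2 * Real.pi)) •
          (circleLift F (τ + x) - circleLift F τ) := by
    simp only [smul_sub]
    rw [intervalIntegral.integral_sub (Continuous.intervalIntegrable (by fun_prop) _ _)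
      (Continuous.intervalIntegrable (by fun_prop) _ _), ← poissonExtension_radial,
      intervalIntegral.integral_smul_const, intervalIntegral.integral_div,
      integral_radialPoisson hr.1.le hr.2, div_self Real.two_pi_pos.ne', one_smul, neg_sub]
  have hgc : Continuous fun x => gramArea (circleLift F (τ + x) - circleLift F τ) b :=
    continuous_gramArea.comp (Continuous.prodMk (by fun_prop) continuous_const)
  have e2 : gramArea (∫ x in (-Real.pi)..Real.pi, (radialPoisson r x / (2 * Real.pi)) •
          (circleLift F (τ + x) - circleLift F τ)) b
      ≤ ∫ x in (-Real.pi)..Real.pi, radialPoisson r x / (2 * Real.pi) *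
          gramArea (circleLift F (τ + x) - circleLift F τ) b := by
    rw [gramArea_eq_norm_gramMap, ← (gramMap b).intervalIntegral_comp_comm
      (Continuous.intervalIntegrable (by fun_prop) _ _)]
    refine (intervalIntegral.norm_integral_le_integral_norm hπ).trans (le_of_eq ?_)
    refine intervalIntegral.integral_congr fun x _ => ?_
    have h0 := radialPoisson_nonneg hr.1.le hr.2 x
    have := Real.pi_pos
    rw [map_smul, norm_smul, Real.norm_of_nonneg (by positivity), gramArea_eq_norm_gramMap]
  rw [e1, smul_neg, ← neg_smul, gramArea_smul_left, abs_neg, abs_of_pos (inv_pos.2 h1r)]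
  calc (1 - r)⁻¹ * gramArea (∫ x in (-Real.pi)..Real.pi, (radialPoisson r x / (2 * Real.pi)) •
          (circleLift F (τ + x) - circleLift F τ)) b
      ≤ (1 - r)⁻¹ * ∫ x in (-Real.pi)..Real.pi, radialPoisson r x / (2 * Real.pi) *
          gramArea (circleLift F (τ + x) - circleLift F τ) b := by gcongr
    _ = ∫ x in (-Real.pi)..Real.pi, (1 - r)⁻¹ * (radialPoisson r x / (2 * Real.pi) *
          gramArea (circleLift F (τ + x) - circleLift F τ) b) := by
        rw [intervalIntegral.integral_const_mul]
    _ ≤ ∫ x in (-Real.pi)..Real.pi, (1 + r) / (2 * r) *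
          (gramArea (circleLift F (τ + x) - circleLift F τ) b /
            (4 * Real.pi * Real.sin (x / 2) ^ 2)) := by
        refine intervalIntegral.integral_mono_on hπ
          (Continuous.intervalIntegrable (by fun_prop) _ _) (hint.const_mul _) fun x hx => ?_
        refine poissonKernel_mul_le hr.1 hr.2 (abs_le.2 hx) (gramArea_nonneg _ _) ?_
        rintro rfl
        simp [gramArea]
    _ = _ := by rw [intervalIntegral.integral_const_mul]

/-- Radial limits of the Jacobian of the Poisson extension of a Lipschitz map. -/
theorem ae_surfaceJacobian_limit {F : Circle → EucSpace n} {L : NNReal}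
    (hF : LipschitzWith L (circleLift F)) :
    ∀ᵐ τ : ℝ, τ ∈ Icc 0 (2 * Real.pi) → DifferentiableAt ℝ (circleLift F) τ ∧ ∃ J : ℝ,
      Tendsto (fun r : ℝ => surfaceJacobian (poissonExtension F) ((r : ℂ) * (Circle.exp τ : ℂ)))
        (𝓝[<] 1) (𝓝 J) ∧
      (IntervalIntegrable (fun x => gramArea (circleLift F (τ + x) - circleLift F τ)
          (deriv (circleLift F) τ) / (4 * Real.pi * Real.sin (x / 2) ^ 2))
          volume (-Real.pi) Real.pi →
        J ≤ ∫ x in (-Real.pi)..Real.pi, gramArea (circleLift F (τ + x) - circleLift F τ)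
          (deriv (circleLift F) τ) / (4 * Real.pi * Real.sin (x / 2) ^ 2)) := by
  obtain ⟨hu, hae⟩ := ae_tendsto_fderiv_poissonExtension hF
  filter_upwards [hae] with τ hτ hmem
  obtain ⟨hd, G, hG, hG'⟩ := hτ hmem
  refine ⟨hd, gramArea G (deriv (circleLift F) τ), ?_, fun hint =>
    gramArea_limit_le_integral hF.continuous (tendsto_radial_quotient hF.continuous hu hG) hint⟩
  have hJ := (continuous_gramArea.tendsto (G, deriv (circleLift F) τ)).comp (hG.prodMk_nhds hG')
  exact hJ.congr fun r => (surfaceJacobian_eq_gramArea _ _ τ).symm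

end

/-! ### Reparametrized curves, Taylor remainders and integrability -/

noncomputable section

section Smooth

variable {E : Type*} [NormedAddCommGroup E] [InnerProductSpace ℝ E]

/-- A continuous reparametrization of an immersed `C¹` curve is differentiable wherever the
reparametrized curve is. -/
theorem differentiableAt_of_comp {H : ℝ → E} (hH : ContDiff ℝ 1 H) {f : ℝ → ℝ} {τ : ℝ}
    (hf : ContinuousAt f τ) (hne : deriv H (f τ) ≠ 0) (hd : DifferentiableAt ℝ (H ∘ f) τ) :
    DifferentiableAt ℝ f τ := by
  set e := deriv H (f τ)
  -- The component of `H` along its tangent at `f τ` has derivative `‖e‖² ≠ 0` and so a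
  -- differentiable local inverse. Near `τ`, by continuity of `f`, `f` is this inverse composed with
  -- `g ∘ f`.
  set g : ℝ → ℝ := fun s => inner ℝ e (H s)
  have hs : HasStrictDerivAt g (inner ℝ e e) (f τ) := by
    have h := hH.contDiffAt.hasStrictDerivAt (x := f τ) one_ne_zero
    exact (innerSL ℝ e).hasStrictFDerivAt.comp_hasStrictDerivAt (f τ) h
  have hne' : inner ℝ e e ≠ (0 : ℝ) := inner_self_ne_zero.2 hne
  have h1 := (hs.to_localInverse hne').hasDerivAt.differentiableAt
  have h2 : DifferentiableAt ℝ (g ∘ f) τ :=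
    (innerSL ℝ e).differentiableAt.comp τ hd
  have h3 := h1.comp τ h2
  refine h3.congr_of_eventuallyEq ?_
  filter_upwards [hf.tendsto.eventually (hs.eventually_left_inverse hne')] with t ht
  exact ht.symm

/-- In this form the averaged derivative makes sense on the diagonal too, where it equals `H'`; the
chord-arc bound relies on this. -/
theorem sub_eq_smul_integral_deriv [CompleteSpace E] {H : ℝ → E} (hH : ContDiff ℝ 1 H) (x y : ℝ) :
    H y - H x = (y - x) • ∫ v in (0 : ℝ)..1, deriv H (x + v * (y - x)) := by
  have hc : Continuous (deriv H) := hH.continuous_deriv le_rfl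
  have hd : ∀ v : ℝ, HasDerivAt (fun v : ℝ => H (x + v * (y - x)))
      ((y - x) • deriv H (x + v * (y - x))) v := by
    intro v
    have h1 : HasDerivAt (fun v : ℝ => x + v * (y - x)) (y - x) v := by
      simpa using ((hasDerivAt_id v).mul_const (y - x)).const_add x
    exact (((hH.differentiable one_ne_zero) _).hasDerivAt).scomp v h1
  rw [← intervalIntegral.integral_smul, intervalIntegral.integral_eq_sub_of_hasDerivAt
    (fun v _ => hd v) (Continuous.intervalIntegrable (by fun_prop) _ _)]
  simp

/-- The bound may depend on `v`, so that in the Hölder case the weight `v^μ` yields the sharp factor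
`1/(1+μ)`. -/
theorem norm_taylor_le [CompleteSpace E] {H : ℝ → E} (hH : ContDiff ℝ 1 H) {s t : ℝ} {b : ℝ → ℝ}
    (hb : IntervalIntegrable b volume 0 1)
    (hHb : ∀ v ∈ Ioc (0 : ℝ) 1, ‖deriv H (s + v * (t - s)) - deriv H s‖ ≤ b v) :
    ‖H t - H s - (t - s) • deriv H s‖ ≤ |t - s| * ∫ v in (0 : ℝ)..1, b v := by
  have hc : Continuous (deriv H) := hH.continuous_deriv le_rfl
  have e : H t - H s - (t - s) • deriv H s
      = (t - s) • ∫ v in (0 : ℝ)..1, (deriv H (s + v * (t - s)) - deriv H s) := by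
    rw [sub_eq_smul_integral_deriv hH s t, intervalIntegral.integral_sub
      (Continuous.intervalIntegrable (by fun_prop) _ _) (by simp), smul_sub]
    simp
  rw [e, norm_smul, Real.norm_eq_abs]
  gcongr
  exact intervalIntegral.norm_integral_le_of_norm_le zero_le_one (ae_of_all _ hHb) hb

end Smooth

theorem dist_circleExp_le (s t : ℝ) : dist (Circle.exp s) (Circle.exp t) ≤ |s - t| := by
  have e : (Circle.exp s : ℂ) - Circle.exp t
      = Circle.exp t * (Complex.exp (Complex.I * ((s - t : ℝ) : ℂ)) - 1) := by
    rw [mul_sub, mul_one, Circle.coe_exp, Circle.coe_exp, ← Complex.exp_add]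
    congr 2
    push_cast
    ring
  have h : dist (Circle.exp s) (Circle.exp t) = ‖(Circle.exp s : ℂ) - Circle.exp t‖ := by
    rw [← dist_eq_norm]; rfl
  rw [h, e, norm_mul, Circle.norm_coe, one_mul]
  exact Real.norm_exp_I_mul_ofReal_sub_one_le

theorem norm_exp_sub_one_sq (x : ℝ) :
    ‖(Circle.exp x : ℂ) - 1‖ ^ 2 = 4 * Real.sin (x / 2) ^ 2 := by
  rw [Circle.coe_exp, mul_comm, Complex.norm_exp_I_mul_ofReal_sub_one, Real.norm_eq_abs, sq_abs]
  ring

section Integrability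

theorem div_sin_sq_le {k x : ℝ} (hk : 0 ≤ k) (hx0 : x ≠ 0) (hx : |x| ≤ Real.pi) :
    k / (4 * Real.pi * Real.sin (x / 2) ^ 2) ≤ k / x ^ 2 := by
  have h := sq_div_pi_le_sin_half_sq hx
  have hπ := Real.pi_pos
  have hx2 : 0 < x ^ 2 := by positivity
  have h4 : x ^ 2 ≤ 4 * Real.pi * Real.sin (x / 2) ^ 2 := by
    rw [div_pow, div_le_iff₀ (by positivity)] at h
    refine h.trans ?_
    -- From `sin²(x/2) ≥ x²/π²`, the denominator is at least `(4/π) x²`, and `π ≤ 4`.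
    nlinarith [Real.pi_le_four, mul_nonneg (sq_nonneg (Real.sin (x / 2))) hπ.le,
      mul_nonneg (mul_nonneg (sq_nonneg (Real.sin (x / 2))) hπ.le) (sub_nonneg.2 Real.pi_le_four)]
  gcongr

theorem intervalIntegrable_div_sin_sq_right {k ψ : ℝ → ℝ} (hk : Continuous k) (hk0 : ∀ x, 0 ≤ k x)
    {ε : ℝ} (hε : 0 < ε) (hεπ : ε ≤ Real.pi) (hψ : IntervalIntegrable ψ volume 0 ε)
    (hkψ : ∀ x ∈ Ioc 0 ε, k x / x ^ 2 ≤ ψ x) :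
    IntervalIntegrable (fun x => k x / (4 * Real.pi * Real.sin (x / 2) ^ 2)) volume 0 Real.pi := by
  have hπ := Real.pi_pos
  refine IntervalIntegrable.trans (b := ε) ?_ ?_
  · refine hψ.mono_fun' ?_ ?_
    · exact Measurable.aestronglyMeasurable (by fun_prop)
    · rw [uIoc_of_le hε.le]
      refine (ae_restrict_mem measurableSet_Ioc).mono fun x hx => ?_
      have hx1 : |x| ≤ Real.pi := by rw [abs_of_pos hx.1]; exact hx.2.trans hεπ
      have := hk0 x
      change ‖k x / (4 * Real.pi * Real.sin (x / 2) ^ 2)‖ ≤ ψ x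
      rw [Real.norm_of_nonneg (by positivity)]
      exact (div_sin_sq_le (hk0 x) hx.1.ne' hx1).trans (hkψ x hx)
  · refine ContinuousOn.intervalIntegrable ?_
    rw [uIcc_of_le hεπ]
    refine ContinuousOn.div (by fun_prop) (by fun_prop) fun x hx => ?_
    have hx0 : 0 < x := hε.trans_le hx.1
    have : 0 < Real.sin (x / 2) := Real.sin_pos_of_pos_of_lt_pi (by linarith) (by linarith [hx.2])
    positivity

/-- Only the singularity at the origin matters, where `ψ` dominates; the left half follows by
reflection. -/
theorem intervalIntegrable_div_sin_sq {k ψ : ℝ → ℝ} (hk : Continuous k) (hk0 : ∀ x, 0 ≤ k x)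
    {ε : ℝ} (hε : 0 < ε) (hεπ : ε ≤ Real.pi) (hψ : IntervalIntegrable ψ volume 0 ε)
    (hkψ : ∀ x, |x| ∈ Ioc 0 ε → k x / x ^ 2 ≤ ψ |x|) :
    IntervalIntegrable (fun x => k x / (4 * Real.pi * Real.sin (x / 2) ^ 2)) volume
      (-Real.pi) Real.pi := by
  have h1 := intervalIntegrable_div_sin_sq_right hk hk0 hε hεπ hψ fun x hx => by
    simpa [abs_of_pos hx.1] using hkψ x (by rwa [abs_of_pos hx.1])
  have h2 := intervalIntegrable_div_sin_sq_right (hk.comp continuous_neg) (fun x => hk0 _)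
    hε hεπ hψ fun x hx => by
      simpa [abs_of_pos hx.1] using hkψ (-x) (by rwa [abs_neg, abs_of_pos hx.1])
  refine IntervalIntegrable.trans (b := 0) ?_ h1
  rw [IntervalIntegrable.iff_comp_neg, neg_neg, neg_zero]
  refine h2.symm.congr fun x _ => ?_
  simp [neg_div]

end Integrability

/-! ### Chord-arc constant and pointwise bounds for the kernel -/

variable {n : ℕ}

theorem modulusOfContinuity_bound {g : ℝ → EucSpace n} {B : ℝ} (hB : ∀ x, ‖g x‖ ≤ B) {x y δ : ℝ}
    (h : |x - y| ≤ δ) : ‖g x - g y‖ ≤ modulusOfContinuity g δ := by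
  refine le_csSup ⟨B + B, ?_⟩ ⟨x, y, h, rfl⟩
  rintro r ⟨x, y, -, rfl⟩
  exact (norm_sub_le _ _).trans (add_le_add (hB x) (hB y))

theorem holderSeminormDeriv_nonneg (μ : ℝ) (h : Circle → EucSpace n) :
    0 ≤ holderSeminormDeriv μ h := by
  refine Real.sSup_nonneg ?_
  rintro r ⟨x, y, -, rfl⟩
  positivity

theorem norm_deriv_sub_le_holder {μ : ℝ} {h : Circle → EucSpace n} (hh : IsC1HolderParam μ h)
    (x y : ℝ) : ‖deriv (circleLift h) x - deriv (circleLift h) y‖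
      ≤ holderSeminormDeriv μ h * |x - y| ^ μ := by
  rcases eq_or_ne x y with rfl | hxy
  · simp only [sub_self, norm_zero]
    exact mul_nonneg (holderSeminormDeriv_nonneg μ h) (Real.rpow_nonneg (abs_nonneg _) _)
  have hpos : ∀ x y : ℝ, x ≠ y → 0 < |x - y| ^ μ := fun x y h =>
    Real.rpow_pos_of_pos (abs_pos.2 (sub_ne_zero.2 h)) _
  obtain ⟨C, hC⟩ := hh.holder
  rw [← div_le_iff₀ (hpos x y hxy)]
  refine le_csSup ⟨C, ?_⟩ ⟨x, y, hxy, rfl⟩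
  rintro r ⟨x, y, hxy, rfl⟩
  rw [div_le_iff₀ (hpos x y hxy)]
  exact hC x y

theorem circleLift_ne {h : Circle → EucSpace n} (hh : Function.Injective h) {x y : ℝ} (hxy : x ≠ y)
    (hle : |x - y| ≤ Real.pi) : circleLift h x ≠ circleLift h y := by
  intro he
  obtain ⟨m, hm⟩ := Circle.exp_eq_exp.1 (hh he)
  have hπ := Real.pi_pos
  rw [hm, add_sub_cancel_left, abs_mul, abs_of_pos Real.two_pi_pos] at hle
  have hm1 : |(m : ℝ)| < 1 := by nlinarith
  have hm0 : m = 0 := by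
    rw [← Int.abs_lt_one_iff]; exact_mod_cast hm1
  rw [hm0] at hm
  exact hxy (by simpa using hm)

/-- The quotient is the norm of the averaged derivative `Φ`, continuous up to the diagonal. It is
nonzero there by regularity and off it by injectivity, so compactness gives a positive minimum. -/
theorem chordArcInf_pos_and_le {h : Circle → EucSpace n} (hh : IsSmoothJordanParam h) :
    0 < chordArcInf h ∧ ∀ x y : ℝ, |x - y| ≤ Real.pi →
      chordArcInf h * |x - y| ≤ ‖circleLift h x - circleLift h y‖ := by
  set H := circleLift h
  have hc : Continuous (deriv H) := hh.contDiff.continuous_deriv le_rfl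
  have hπ := Real.pi_pos
  set Φ : ℝ × ℝ → EucSpace n := fun p => ∫ v in (0 : ℝ)..1, deriv H (p.1 + v * (p.2 - p.1))
  have hΦ : Continuous Φ :=
    intervalIntegral.continuous_parametric_intervalIntegral_of_continuous' (by
      unfold Function.uncurry; fun_prop) _ _
  have hΦ0 : ∀ x y : ℝ, |x - y| ≤ Real.pi → Φ (x, y) ≠ 0 := by
    intro x y hxy h0
    rcases eq_or_ne x y with rfl | hne
    · simp only [Φ, sub_self, mul_zero, add_zero, intervalIntegral.integral_const, sub_zero,
        one_smul] at h0
      exact hh.deriv_ne_zero x h0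
    · have e := sub_eq_smul_integral_deriv hh.contDiff x y
      change H y - H x = (y - x) • Φ (x, y) at e
      rw [h0, smul_zero, sub_eq_zero] at e
      exact circleLift_ne hh.injective hne hxy e.symm
  have hquot : ∀ x y : ℝ, 0 < |x - y| → ‖H x - H y‖ / |x - y| = ‖Φ (x, y)‖ := by
    intro x y hxy
    have e := sub_eq_smul_integral_deriv hh.contDiff x y
    change H y - H x = (y - x) • Φ (x, y) at e
    rw [norm_sub_rev, e, norm_smul, Real.norm_eq_abs, abs_sub_comm y x,
      mul_div_cancel_left₀ _ hxy.ne']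
  -- By periodicity `x` may be taken in `[0, 2π]`; a point within `π` of it lies in `[-π, 3π]`.
  set K : Set (ℝ × ℝ) := (Icc 0 (2 * Real.pi) ×ˢ Icc (-Real.pi) (3 * Real.pi)) ∩
    {p | |p.1 - p.2| ≤ Real.pi}
  have hK : IsCompact K := (isCompact_Icc.prod isCompact_Icc).inter_right
    (isClosed_le (by fun_prop) continuous_const)
  have hKne : K.Nonempty := ⟨(0, 0), by
    simp only [K, mem_inter_iff, mem_prod, mem_Icc, mem_ofPred_eq, sub_zero, abs_zero]
    refine ⟨⟨⟨le_rfl, ?_⟩, ?_, ?_⟩, hπ.le⟩ <;> linarith⟩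
  obtain ⟨p, hpK, hp⟩ := hK.exists_isMinOn hKne (hΦ.norm.continuousOn)
  have hm0 : 0 < ‖Φ p‖ := norm_pos_iff.2 (hΦ0 p.1 p.2 hpK.2)
  have hlow : ∀ x y : ℝ, 0 < |x - y| → |x - y| ≤ Real.pi → ‖Φ p‖ ≤ ‖H x - H y‖ / |x - y| := by
    intro x y h0 hle
    set k := toIcoDiv Real.two_pi_pos 0 x
    have hx := sub_toIcoDiv_zsmul_mem_Ico Real.two_pi_pos 0 x
    rw [zero_add] at hx
    set x' := x - k • (2 * Real.pi)
    set y' := y - k • (2 * Real.pi)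
    have hsub : x' - y' = x - y := by simp [x', y']
    have hHx : H x' = H x := (circleLift_periodic h).sub_zsmul_eq k
    have hHy : H y' = H y := (circleLift_periodic h).sub_zsmul_eq k
    rw [← hHx, ← hHy, ← hsub, hquot x' y' (by rwa [hsub])]
    refine hp ⟨⟨Ico_subset_Icc_self hx, ?_⟩, ?_⟩
    · have := abs_le.1 hle
      rw [← hsub] at this
      exact ⟨by linarith [hx.1], by linarith [hx.2]⟩
    · change |x' - y'| ≤ Real.pi
      rwa [hsub]
  have hbdd : BddBelow {r : ℝ | ∃ x y : ℝ, 0 < |x - y| ∧ |x - y| ≤ Real.pi ∧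
      r = ‖H x - H y‖ / |x - y|} := ⟨0, by rintro r ⟨x, y, -, -, rfl⟩; positivity⟩
  refine ⟨hm0.trans_le (le_csInf ⟨_, Real.pi, 0, by simp [hπ.ne'], ?_, rfl⟩ ?_),
    fun x y hxy => ?_⟩
  · simp [abs_of_pos hπ]
  · rintro r ⟨x, y, h0, hle, rfl⟩
    exact hlow x y h0 hle
  · rcases (abs_nonneg (x - y)).eq_or_lt with h0 | h0
    · rw [← h0, mul_zero]; exact norm_nonneg _
    · rw [← le_div_iff₀ h0]
      exact csInf_le hbdd ⟨x, y, h0, hxy, rfl⟩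

theorem kernelK_eq_gramArea (h : Circle → EucSpace n) (s t : ℝ) :
    kernelK h s t = gramArea (circleLift h t - circleLift h s) (deriv (circleLift h) s) := rfl

/-- Subtracting `(t - s) h'(s)` from the chord leaves the area unchanged and replaces the chord by
its Taylor remainder. -/
theorem kernelK_le_modulus {h : Circle → EucSpace n} (hh : IsSmoothJordanParam h) (s t : ℝ) :
    kernelK h s t ≤ |t - s| * modulusOfContinuity (deriv (circleLift h)) |t - s| *
      ‖deriv (circleLift h) s‖ := by
  have hc : Continuous (deriv (circleLift h)) := hh.contDiff.continuous_deriv le_rfl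
  have hper : Function.Periodic (deriv (circleLift h)) (2 * Real.pi) := fun x => by
    rw [← deriv_comp_add_const]
    congr 1
    exact funext (circleLift_periodic h)
  obtain ⟨B, hB⟩ := exists_norm_le_of_periodic hc hper
  rw [kernelK_eq_gramArea, ← gramArea_sub_smul_left _ _ (t - s)]
  refine (gramArea_le_mul _ _).trans ?_
  gcongr
  refine (norm_taylor_le (b := fun _ => modulusOfContinuity (deriv (circleLift h)) |t - s|)
    hh.contDiff (by simp) fun v hv => ?_).trans (by simp)
  refine modulusOfContinuity_bound hB ?_
  rw [add_sub_cancel_left, abs_mul, abs_of_pos hv.1]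
  exact mul_le_of_le_one_left (abs_nonneg _) hv.2

/-- Here the tangent is corrected by a multiple of the chord, so one full factor `‖a‖` survives; the
remaining `|d|^μ` is converted to `(‖a‖/m)^μ` by the chord-arc inequality. -/
theorem kernelK_le_holder {μ : ℝ} (hμ : 0 < μ) {h : Circle → EucSpace n}
    (hh : IsC1HolderParam μ h) (s t : ℝ) :
    kernelK h s t ≤ holderSeminormDeriv μ h / ((1 + μ) * chordArcInf h ^ μ) *
      ‖circleLift h t - circleLift h s‖ ^ (1 + μ) := by
  set H := circleLift h with hH
  obtain ⟨hm, hmle⟩ := chordArcInf_pos_and_le hh.param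
  set m := chordArcInf h
  set M := holderSeminormDeriv μ h with hM
  have hM0 : 0 ≤ M := holderSeminormDeriv_nonneg μ h
  have hπ := Real.pi_pos
  -- Full turns bring `t` within `π` of `s`, where the chord-arc inequality is available.
  set k := round ((t - s) / (2 * Real.pi))
  set t' := t - k • (2 * Real.pi) with ht'
  have hHt : H t' = H t := (circleLift_periodic h).sub_zsmul_eq k
  have hle : |t' - s| ≤ Real.pi := by
    have h1 := abs_sub_round ((t - s) / (2 * Real.pi))
    have h2 : t' - s = ((t - s) / (2 * Real.pi) - k) * (2 * Real.pi) := by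
      rw [ht', zsmul_eq_mul]; field_simp; ring
    rw [h2, abs_mul, abs_of_pos Real.two_pi_pos]
    nlinarith
  rw [kernelK_eq_gramArea, ← hH, ← hHt]
  set a := H t' - H s with ha
  set b := deriv H s with hb
  rcases eq_or_ne t' s with he | hne
  · have : a = 0 := by rw [ha, he, sub_self]
    rw [this, gramArea_eq_norm_gramMap, map_zero, norm_zero]
    positivity
  set d := t' - s with hd
  have hd0 : d ≠ 0 := sub_ne_zero.2 hne
  have hdabs : 0 < |d| := abs_pos.2 hd0
  have hT : ‖a - d • b‖ ≤ |d| * (M * |d| ^ μ / (1 + μ)) := by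
    refine (norm_taylor_le hh.param.contDiff (s := s) (t := t')
      (b := fun v => M * |d| ^ μ * v ^ μ)
      ((intervalIntegral.intervalIntegrable_rpow' (by linarith)).const_mul _)
      fun v hv => ?_).trans (le_of_eq ?_)
    · refine (norm_deriv_sub_le_holder hh _ _).trans (le_of_eq ?_)
      rw [add_sub_cancel_left, abs_mul, abs_of_pos hv.1, Real.mul_rpow hv.1.le (abs_nonneg _)]
      ring
    · rw [intervalIntegral.integral_const_mul, integral_rpow (Or.inl (by linarith)),
        Real.zero_rpow (by linarith), Real.one_rpow, add_comm μ 1]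
      ring
  have hba : ‖b - d⁻¹ • a‖ ≤ M * |d| ^ μ / (1 + μ) := by
    have e : b - d⁻¹ • a = (-d⁻¹) • (a - d • b) := by
      rw [smul_sub (-d⁻¹) a, smul_smul, neg_mul, inv_mul_cancel₀ hd0]; module
    rw [e, norm_smul, norm_neg, norm_inv, Real.norm_eq_abs]
    calc |d|⁻¹ * ‖a - d • b‖ ≤ |d|⁻¹ * (|d| * (M * |d| ^ μ / (1 + μ))) := by gcongr
      _ = _ := by rw [inv_mul_cancel_left₀ hdabs.ne']
  have hda : |d| ≤ ‖a‖ / m := by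
    rw [le_div_iff₀ hm, mul_comm]
    exact hmle t' s hle
  have ha0 : 0 < ‖a‖ := by
    refine norm_pos_iff.2 (sub_ne_zero.2 (circleLift_ne hh.param.injective hne hle))
  calc gramArea a b = gramArea (b - d⁻¹ • a) a := by
        rw [gramArea_sub_smul_left, gramArea_comm]
    _ ≤ ‖b - d⁻¹ • a‖ * ‖a‖ := gramArea_le_mul _ _
    _ ≤ M * |d| ^ μ / (1 + μ) * ‖a‖ := by gcongr
    _ ≤ M * (‖a‖ / m) ^ μ / (1 + μ) * ‖a‖ := by gcongr
    _ = M / ((1 + μ) * m ^ μ) * ‖a‖ ^ (1 + μ) := by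
        rw [Real.div_rpow ha0.le hm.le, Real.rpow_add ha0, Real.rpow_one]
        field_simp

end

/-! ### Finiteness of the integrals and reduction to Lipschitz boundary maps -/

noncomputable section

variable {n : ℕ}

theorem continuous_kernelK_comp {h : Circle → EucSpace n} (hh : IsSmoothJordanParam h) {f : ℝ → ℝ}
    (hf : Continuous f) (s : ℝ) : Continuous fun t => kernelK h s (f t) := by
  have hc : Continuous (circleLift h) := hh.contDiff.continuous
  simp only [kernelK_eq_gramArea]
  exact continuous_gramArea.comp (Continuous.prodMk (by fun_prop) continuous_const)

theorem intervalIntegrable_kernelK_of_dini {h : Circle → EucSpace n} (hh : IsDiniSmoothParam h)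
    {f : ℝ → ℝ} (hf : Continuous f) {τ : ℝ} (hd : DifferentiableAt ℝ f τ) :
    IntervalIntegrable (fun x => kernelK h (f τ) (f (τ + x)) /
      (4 * Real.pi * Real.sin (x / 2) ^ 2)) volume (-Real.pi) Real.pi := by
  set ω := modulusOfContinuity (deriv (circleLift h))
  obtain ⟨M, hM, hO⟩ := hd.isBigO_sub.exists_pos
  obtain ⟨δ, hδ, hball⟩ := Metric.eventually_nhds_iff.1 hO.bound
  obtain ⟨l, hl, hint⟩ := hh.dini.integrable
  -- The three bounds keep `x` where `|f(τ+x) - f(τ)| ≤ M|x|` holds, keep `M|x|` in the Dini range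
  -- `(0, l]`, and keep `|x| ≤ π`.
  set ε := min (min (δ / 2) (l / M)) Real.pi
  have hε : 0 < ε := by
    have := Real.pi_pos
    positivity
  have hεδ : ε < δ := lt_of_le_of_lt ((min_le_left _ _).trans (min_le_left _ _)) (by linarith)
  have hεl : ε ≤ l / M := (min_le_left _ _).trans (min_le_right _ _)
  have hψ : IntervalIntegrable (fun x => M ^ 2 * ‖deriv (circleLift h) (f τ)‖ *
      (ω (M * x) / (M * x))) volume 0 ε := by
    refine IntervalIntegrable.const_mul ?_ _
    have h1 : IntervalIntegrable (fun t => ω t / t) volume 0 l :=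
      (intervalIntegrable_iff_integrableOn_Ioc_of_le hl.le).2 hint
    have h2 := h1.comp_mul_left (c := M)
    rw [zero_div] at h2
    refine h2.mono_set ?_
    rw [uIcc_of_le hε.le, uIcc_of_le (hε.le.trans hεl)]
    exact Icc_subset_Icc_right hεl
  refine intervalIntegrable_div_sin_sq
    ((continuous_kernelK_comp hh.param hf (f τ)).comp (continuous_const.add continuous_id))
    (fun x => Real.sqrt_nonneg _) hε (min_le_right _ _) hψ fun x hx => ?_
  have hfx : |f (τ + x) - f τ| ≤ M * |x| := by
    have := @hball (τ + x) (by simpa using hx.2.trans_lt hεδ)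
    simpa using this
  have hK := kernelK_le_modulus hh.param (f τ) (f (τ + x))
  have hω : ω |f (τ + x) - f τ| ≤ ω (M * |x|) :=
    hh.dini.monotoneOn (mem_Ici.2 (abs_nonneg _)) (mul_nonneg hM.le (abs_nonneg _)) hfx
  have hω0 : 0 ≤ ω |f (τ + x) - f τ| := by
    rw [← hh.dini.zero]
    exact hh.dini.monotoneOn self_mem_Ici (mem_Ici.2 (abs_nonneg _)) (abs_nonneg _)
  have hx2 : 0 < x ^ 2 := by rw [← sq_abs]; exact pow_pos hx.1 2
  have hx1 := hx.1
  rw [div_le_iff₀ hx2, ← sq_abs x]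
  calc kernelK h (f τ) (f (τ + x))
      ≤ |f (τ + x) - f τ| * ω |f (τ + x) - f τ| * ‖deriv (circleLift h) (f τ)‖ := hK
    _ ≤ M * |x| * ω (M * |x|) * ‖deriv (circleLift h) (f τ)‖ := by gcongr
    _ = _ := by field_simp

/-- The Lipschitz bound makes the integrand `O(|x|^(μ-1))`, which is integrable since `μ > 0`. -/
theorem intervalIntegrable_chord_rpow {F : Circle → EucSpace n} {L : NNReal}
    (hF : LipschitzWith L (circleLift F)) {μ : ℝ} (hμ : 0 < μ) (φ : ℝ) :
    IntervalIntegrable (fun x => ‖circleLift F (φ + x) - circleLift F φ‖ ^ (1 + μ) /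
      (4 * Real.pi * Real.sin (x / 2) ^ 2)) volume (-Real.pi) Real.pi := by
  have hc := hF.continuous
  refine intervalIntegrable_div_sin_sq (ψ := fun x => (L : ℝ) ^ (1 + μ) * x ^ (μ - 1))
    (Continuous.rpow_const (by fun_prop) fun x => Or.inr (by linarith))
    (fun x => Real.rpow_nonneg (norm_nonneg _) _) Real.pi_pos le_rfl
    ((intervalIntegral.intervalIntegrable_rpow' (by linarith)).const_mul _) fun x hx => ?_
  have hx1 := hx.1
  have hL : ‖circleLift F (φ + x) - circleLift F φ‖ ≤ L * |x| := by
    have := hF.dist_le_mul (φ + x) φ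
    simpa [dist_eq_norm] using this
  have hx2 : 0 < x ^ 2 := by rw [← sq_abs]; exact pow_pos hx.1 2
  rw [div_le_iff₀ hx2, ← sq_abs x]
  calc ‖circleLift F (φ + x) - circleLift F φ‖ ^ (1 + μ) ≤ (L * |x|) ^ (1 + μ) :=
        Real.rpow_le_rpow (norm_nonneg _) hL (by linarith)
    _ = (L : ℝ) ^ (1 + μ) * (|x| ^ (μ - 1) * |x| ^ 2) := by
        rw [Real.mul_rpow L.coe_nonneg hx1.le, ← Real.rpow_natCast, ← Real.rpow_add hx1]
        congr 2
        push_cast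
        ring
    _ = _ := by ring

theorem lipschitzWith_circleLift {F : Circle → EucSpace n} {L : NNReal} (hF : LipschitzWith L F) :
    LipschitzWith L (circleLift F) := by
  refine LipschitzWith.of_dist_le_mul fun s t => (hF.dist_le_mul _ _).trans ?_
  gcongr
  exact dist_circleExp_le s t

/-- The boundary values are radial limits of `P[F]` and inherit its Lipschitz constant. -/
theorem lipschitzWith_circleLift_of_poissonExtension {F : Circle → EucSpace n} {L : NNReal}
    (hF : Continuous (circleLift F))
    (hu : LipschitzOnWith L (poissonExtension F) (Metric.ball 0 1)) :
    LipschitzWith L (circleLift F) := by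
  refine LipschitzWith.of_dist_le_mul fun s t => ?_
  have hlim := (tendsto_poissonExtension hF s).dist (tendsto_poissonExtension hF t)
  refine le_of_tendsto hlim ?_
  filter_upwards [Ioo_mem_nhdsLT (show (0 : ℝ) < 1 by norm_num)] with r hr
  have hmem : ∀ s : ℝ, (r : ℂ) * (Circle.exp s : ℂ) ∈ Metric.ball (0 : ℂ) 1 := fun s => by
    rw [mem_ball_zero_iff, Circle.coe_exp, norm_ofReal_mul_exp r s hr.1.le]; exact hr.2
  refine (hu.dist_le_mul _ (hmem s) _ (hmem t)).trans ?_
  gcongr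
  have h1 := dist_circleExp_le s t
  have h2 : dist ((r : ℂ) * (Circle.exp s : ℂ)) ((r : ℂ) * (Circle.exp t : ℂ))
      = r * dist (Circle.exp s) (Circle.exp t) := by
    rw [dist_eq_norm, ← mul_sub, norm_mul, Complex.norm_real, Real.norm_of_nonneg hr.1.le,
      ← dist_eq_norm]
    rfl
  rw [h2, Real.dist_eq]
  nlinarith [hr.1, hr.2, dist_nonneg (x := Circle.exp s) (y := Circle.exp t)]

/-- The Jacobian of the Poisson extension of a Lipschitz reparametrization `h ∘ f`. -/
theorem ae_surfaceJacobian_le_kernelK {h F : Circle → EucSpace n} {f : ℝ → ℝ}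
    (hh : IsSmoothJordanParam h) {L : NNReal} (hF : LipschitzWith L (circleLift F))
    (hf : Continuous f) (hFf : ∀ t : ℝ, F (Circle.exp t) = h (Circle.exp (f t))) :
    ∀ᵐ τ : ℝ, τ ∈ Icc 0 (2 * Real.pi) → DifferentiableAt ℝ f τ ∧ ∃ J : ℝ,
      Tendsto (fun r : ℝ => surfaceJacobian (poissonExtension F) ((r : ℂ) * (Circle.exp τ : ℂ)))
        (𝓝[<] 1) (𝓝 J) ∧
      (IntervalIntegrable (fun x => kernelK h (f τ) (f (τ + x)) /
          (4 * Real.pi * Real.sin (x / 2) ^ 2)) volume (-Real.pi) Real.pi →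
        J ≤ |deriv f τ| * ∫ x in (-Real.pi)..Real.pi, kernelK h (f τ) (f (τ + x)) /
          (4 * Real.pi * Real.sin (x / 2) ^ 2)) := by
  have hcomp : circleLift F = circleLift h ∘ f := funext hFf
  filter_upwards [ae_surfaceJacobian_limit hF] with τ hτ hmem
  obtain ⟨hd, J, hJ, hJle⟩ := hτ hmem
  rw [hcomp] at hd
  have hfd := differentiableAt_of_comp hh.contDiff hf.continuousAt (hh.deriv_ne_zero (f τ)) hd
  refine ⟨hfd, J, hJ, fun hint => ?_⟩
  have hderiv : deriv (circleLift F) τ = deriv f τ • deriv (circleLift h) (f τ) := by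
    rw [hcomp]
    exact (((hh.contDiff.differentiable one_ne_zero) _).hasDerivAt.scomp τ hfd.hasDerivAt).deriv
  have e : ∀ x, gramArea (circleLift F (τ + x) - circleLift F τ) (deriv (circleLift F) τ) /
      (4 * Real.pi * Real.sin (x / 2) ^ 2) = |deriv f τ| * (kernelK h (f τ) (f (τ + x)) /
          (4 * Real.pi * Real.sin (x / 2) ^ 2)) := by
    intro x
    rw [hderiv, gramArea_smul_right, hcomp, kernelK_eq_gramArea, mul_div_assoc]
    rfl
  simp only [e] at hJle
  rw [← intervalIntegral.integral_const_mul]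
  exact hJle (hint.const_mul _)

end

/-! ### Assembly of the Dini smooth and Hölder cases -/

theorem mainTheorem5 (n : ℕ) :
    -- Dini smooth case
    (∀ (h F : Circle → EucSpace n) (f : ℝ → ℝ),
      IsDiniSmoothParam h →
      (∃ L : NNReal, LipschitzWith L F) →
      IsWeakHomeo F (range h) →
      Continuous f →
      (∀ t : ℝ, F (Circle.exp t) = h (Circle.exp (f t))) →
      ∀ᵐ τ : ℝ, τ ∈ Icc 0 (2 * Real.pi) →
        DifferentiableAt ℝ f τ ∧
        IntervalIntegrable
          (fun t : ℝ => kernelK h (f τ) (f t) / (4 * Real.pi * Real.sin ((t - τ) / 2) ^ 2))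
          volume 0 (2 * Real.pi) ∧
        ∃ J : ℝ,
          Tendsto
            (fun r : ℝ => surfaceJacobian (poissonExtension F) ((r : ℂ) * (Circle.exp τ : ℂ)))
            (𝓝[<] 1) (𝓝 J) ∧
          J ≤ |deriv f τ| * ∫ t in (0 : ℝ)..2 * Real.pi,
            kernelK h (f τ) (f t) / (4 * Real.pi * Real.sin ((t - τ) / 2) ^ 2)) ∧
    -- `C^{1,μ}` case
    (∀ (μ : ℝ) (h F : Circle → EucSpace n) (f : ℝ → ℝ),
      0 < μ → μ ≤ 1 →
      IsC1HolderParam μ h →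
      (((∃ L : NNReal, LipschitzWith L F) ∧ IsWeakHomeo F (range h)) ∨
        (Function.Injective F ∧
          ∃ L : NNReal, LipschitzOnWith L (poissonExtension F) (Metric.ball 0 1))) →
      Continuous f →
      (∀ t : ℝ, F (Circle.exp t) = h (Circle.exp (f t))) →
      ∀ᵐ φ : ℝ, φ ∈ Icc 0 (2 * Real.pi) →
        DifferentiableAt ℝ f φ ∧
        IntervalIntegrable
          (fun x : ℝ => ‖F (Circle.exp (φ + x)) - F (Circle.exp φ)‖ ^ (1 + μ) /
            (Real.pi * ‖(Circle.exp x : ℂ) - 1‖ ^ 2))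
          volume (-Real.pi) Real.pi ∧
        ∃ J : ℝ,
          Tendsto
            (fun r : ℝ => surfaceJacobian (poissonExtension F) ((r : ℂ) * (Circle.exp φ : ℂ)))
            (𝓝[<] 1) (𝓝 J) ∧
          J ≤ holderSeminormDeriv μ h / ((1 + μ) * chordArcInf h ^ μ) * |deriv f φ| *
            ∫ x in (-Real.pi)..Real.pi,
              ‖F (Circle.exp (φ + x)) - F (Circle.exp φ)‖ ^ (1 + μ) /
                (Real.pi * ‖(Circle.exp x : ℂ) - 1‖ ^ 2)) := by
  refine ⟨fun h F f hh hF _ hf hFf => ?_, fun μ h F f hμ _ hh hF hf hFf => ?_⟩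
  · obtain ⟨L, hL⟩ := hF
    filter_upwards [ae_surfaceJacobian_le_kernelK hh.param (lipschitzWith_circleLift hL) hf hFf]
      with τ hτ hmem
    obtain ⟨hd, J, hJ, hJle⟩ := hτ hmem
    have hint := intervalIntegrable_kernelK_of_dini hh hf hd
    set q : ℝ → ℝ := fun t =>
      kernelK h (f τ) (f t) / (4 * Real.pi * Real.sin ((t - τ) / 2) ^ 2) with hq
    have hqx : ∀ x, kernelK h (f τ) (f (τ + x)) / (4 * Real.pi * Real.sin (x / 2) ^ 2)
        = q (τ + x) := fun x => by simp [hq]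
    -- `f` itself need not be periodic, but it enters only through `h(e^{if(t)}) = F(e^{it})`; the
    -- half-angle sine changes sign and is squared. Periodicity moves the integral from `[τ-π, τ+π]`
    -- to `[0, 2π]`.
    have hper : Function.Periodic q (2 * Real.pi) := by
      intro t
      have e1 : circleLift h (f (t + 2 * Real.pi)) = circleLift h (f t) := by
        change h _ = h _
        rw [← hFf, ← hFf, Circle.exp_add]; simp
      have e2 : (t + 2 * Real.pi - τ) / 2 = (t - τ) / 2 + Real.pi := by ring
      simp only [hq, kernelK, e1, e2, Real.sin_add_pi, neg_sq]
    simp only [hqx] at hint hJle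
    refine ⟨hd, ?_, J, hJ, ?_⟩
    · refine hper.intervalIntegrable Real.two_pi_pos.ne' (t := τ - Real.pi) ?_ _ _
      have := hint.comp_sub_right τ
      simp only [add_sub_cancel] at this
      convert this using 1 <;> ring
    · rw [integral_shift_of_periodic hper τ]
      exact hJle hint
  · have hcomp : circleLift F = circleLift h ∘ f := funext hFf
    have hFc : Continuous (circleLift F) := by
      rw [hcomp]; exact hh.param.contDiff.continuous.comp hf
    -- Both alternatives enter only through the Lipschitz property of the boundary map.
    obtain ⟨L, hL⟩ : ∃ L : NNReal, LipschitzWith L (circleLift F) := by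
      rcases hF with ⟨⟨L, hL⟩, -⟩ | ⟨-, L, hL⟩
      · exact ⟨L, lipschitzWith_circleLift hL⟩
      · exact ⟨L, lipschitzWith_circleLift_of_poissonExtension hFc hL⟩
    filter_upwards [ae_surfaceJacobian_le_kernelK hh.param hL hf hFf] with φ hφ hmem
    obtain ⟨hd, J, hJ, hJle⟩ := hφ hmem
    have hint := intervalIntegrable_chord_rpow hL hμ φ
    have hden : ∀ x : ℝ, 4 * Real.pi * Real.sin (x / 2) ^ 2
        = Real.pi * ‖(Circle.exp x : ℂ) - 1‖ ^ 2 := fun x => by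
      rw [norm_exp_sub_one_sq]; ring
    have hpt : ∀ x, kernelK h (f φ) (f (φ + x)) / (4 * Real.pi * Real.sin (x / 2) ^ 2)
        ≤ holderSeminormDeriv μ h / ((1 + μ) * chordArcInf h ^ μ) *
          (‖circleLift F (φ + x) - circleLift F φ‖ ^ (1 + μ) /
            (4 * Real.pi * Real.sin (x / 2) ^ 2)) := by
      intro x
      have hπ := Real.pi_pos
      rw [← mul_div_assoc, hcomp]
      exact div_le_div_of_nonneg_right (kernelK_le_holder hμ hh (f φ) (f (φ + x))) (by positivity)
    have hintK : IntervalIntegrable (fun x => kernelK h (f φ) (f (φ + x)) /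
        (4 * Real.pi * Real.sin (x / 2) ^ 2)) volume (-Real.pi) Real.pi := by
      refine (hint.const_mul _).mono_fun' ?_ (ae_of_all _ fun x => ?_)
        (g := fun x => holderSeminormDeriv μ h / ((1 + μ) * chordArcInf h ^ μ) *
          (‖circleLift F (φ + x) - circleLift F φ‖ ^ (1 + μ) /
            (4 * Real.pi * Real.sin (x / 2) ^ 2)))
      · have hk := (continuous_kernelK_comp hh.param hf (f φ)).comp
          (continuous_const.add continuous_id : Continuous fun x : ℝ => φ + x)
        exact (hk.measurable.div (by fun_prop)).aestronglyMeasurable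
      · have hπ := Real.pi_pos
        have h0 : 0 ≤ kernelK h (f φ) (f (φ + x)) := Real.sqrt_nonneg _
        exact (Real.norm_of_nonneg (by positivity)).trans_le (hpt x)
    have hle : ∫ x in (-Real.pi)..Real.pi, kernelK h (f φ) (f (φ + x)) /
        (4 * Real.pi * Real.sin (x / 2) ^ 2)
        ≤ holderSeminormDeriv μ h / ((1 + μ) * chordArcInf h ^ μ) *
          ∫ x in (-Real.pi)..Real.pi, ‖circleLift F (φ + x) - circleLift F φ‖ ^ (1 + μ) /
            (4 * Real.pi * Real.sin (x / 2) ^ 2) := by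
      rw [← intervalIntegral.integral_const_mul]
      exact intervalIntegral.integral_mono_on (by linarith [Real.pi_pos]) hintK (hint.const_mul _)
        fun x _ => hpt x
    simp only [hden] at hint hle hintK hJle
    refine ⟨hd, hint, J, hJ, (hJle hintK).trans ?_⟩
    refine (mul_le_mul_of_nonneg_left hle (abs_nonneg _)).trans (le_of_eq ?_)
    rw [← mul_assoc, mul_comm |deriv f φ|]
    rfl
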